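/- **Setting.** Let $p$ be a prime and let $X$ be an $F$-finite integral scheme (separated, noetherian) of characteristic $p$ with function field $L$ and generic point $\eta$; $F$-finite means that the Frobenius morphism of $X$ is finite. A $p^{-e}$-linear map on a field $K$ is an additive map $\psi:K\to K$ with $\psi(f^{p^e}g)=f\psi(g)$. Let $\mathcal C^X=\bigoplus_{e\ge0}\mathcal C^X_e$, where $\mathcal C^X_e$ is the sheaf of $p^{-e}$-linear maps $\psi$ on $L$ with $\psi(\mathcal O_X)\subseteq\mathcal O_X$; it is a sheaf of graded rings under composition. A *Cartier subalgebra* on $X$ is a quasi-coherent sheaf of graded subrings $\mathcal D=\bigoplus_{e\ge0}\mathcal D_e\subseteq\mathcal C^X$ with $\mathcal D_0=\mathcal C^X_0=\mathcal O_X$. $\mathcal D$ is *sharply $F$-pure* if for every $x\in X$ there are $e\ge1$ and $\psi\in(\mathcal D_e)_x$ with $\psi(\mathcal O_{X,x})=\mathcal O_{X,x}$. It is *strongly $F$-regular* if for every $x\in X$ and every nonzero $f\in\mathcal O_{X,x}$ there are $e\ge1$ and $\psi\in(\mathcal D_e)_x$ with $\psi(f)=1$. $X$ is *$F$-pure* (resp.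 *$F$-regular*) if $\mathcal C^X$ is sharply $F$-pure (resp. strongly $F$-regular). A *semivaluation* $\zeta=(w,z)\in X^\beth$ is a point $z\in X$ (its home), with closure $Z$, together with a valuation $w:\kappa(z)\to\mathbb R\cup\{+\infty\}$ (possibly trivial) that is nonnegative on some local ring of $Z$; its center $c$ is the point of $Z$ whose local ring on $Z$ is dominated by the valuation ring of $w$. For $x\in X$, $\mathrm{triv}_x$ is the trivial valuation on $\kappa(x)$, and $\mathrm{triv}_X=\mathrm{triv}_\eta$. *Log discrepancy.* For a valuation $v$ on a field $K$ and a nonzero $p^{-e}$-linear map $\psi$ on $K$ with $e\ge1$, put $$A(v;\psi)=\sup_{f\ne0,\;n\ge1}\frac{v(f)-p^{ne}\,v(\psi^n(f))}{p^{ne}-1}.$$ The closure $Z$ of a point $z$, with ideal sheaf $\mathcal I_Z$, is *uniformly $\mathcal D$-compatible* if $\psi(\mathcal I_{Z,x})\subseteq\mathcal I_{Z,x}$ for all $x\in X$, $e\ge1$ and $\psi\in(\mathcal D_e)_x$; for $x\in Z$ every such $\psi$ then induces a $p^{-e}$-linear map $\psi\|_Z$ on $\kappa(z)$. For $\zeta=(w,z)$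 with center $c$, let $A(\zeta;\mathcal D)\in[-\infty,+\infty]$ be the supremum of $A(w;\psi\|_Z)$ over all $e\ge1$ and $\psi\in(\mathcal D_e)_c$ with $\psi\|_Z\neq0$ (with $\sup\varnothing=-\infty$) if $Z$ is uniformly $\mathcal D$-compatible, and $A(\zeta;\mathcal D)=+\infty$ otherwise. **Theorem.** Let $\mathcal D$ be a Cartier subalgebra on $X$ with $\mathcal D_e\ne0$ for some $e>0$. 1. $\mathcal D$ is sharply $F$-pure if and only if $A(\zeta;\mathcal D)\ge0$ for all $\zeta\in X^\beth$. 2. $\mathcal D$ is strongly $F$-regular if and only if $A(\zeta;\mathcal D)>0$ for all $\zeta\in X^\beth\setminus\{\mathrm{triv}_X\}$. Moreover, it suffices to test trivial semivaluations: $\mathcal D$ is sharply $F$-pure if and only if $A(\mathrm{triv}_x;\mathcal D)\ge0$ for all $x\in X$, and strongly $F$-regular if and only if $A(\mathrm{triv}_x;\mathcal D)>0$ for all $x\in X\setminus\{\eta\}$. **Corollary.** A divisor $E$ over $X$ is a prime divisor on a normal integral scheme $Y$ with a proper birational morphism $Y\to X$, and $A(E;\mathcal C^X)=A(\mathrm{ord}_E;\mathcal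 C^X)$. If $X$ is $F$-pure, then $A(E;\mathcal C^X)\ge0$ for all divisors $E$ over $X$. If $X$ is $F$-regular, then $A(E;\mathcal C^X)>0$ for all divisors $E$ over $X$. Conversely, if $A(\zeta;\mathcal C^X)\ge0$ (resp. $>0$) for all $\zeta\in X^\beth\setminus\{\mathrm{triv}_X\}$, then $X$ is $F$-pure (resp. $F$-regular). -/

import Mathlib

open AlgebraicGeometry CategoryTheory TopologicalSpace

universe u

noncomputable section

namespace FLogDisc

/-! ### Maps of degree `p⁻ᵉ` on a field, and their log discrepancies -/

/-- An additive map `ψ : K → K` is `p⁻ᵉ`-linear if `ψ (f ^ (p ^ e) * g) = f * ψ g`. -/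
def IsPInvLinear {K : Type*} [Field K] (p e : ℕ) (ψ : AddMonoid.End K) : Prop :=
  ∀ f g : K, ψ (f ^ (p ^ e) * g) = f * ψ g

/-- Multiplication by `a`, as an additive endomorphism of `K`. -/
def mulEnd {K : Type*} [Field K] (a : K) : AddMonoid.End K := AddMonoidHom.mulLeft a

/-- The inclusion `ℝ ∪ {+∞} ⊆ [-∞, +∞]`. -/
def toEReal (a : WithTop ℝ) : EReal := WithTop.recTopCoe ⊤ (fun r : ℝ => (r : EReal)) a

/-- `E(f, ψ, v) = (v(f) - pᵉ v(ψ(f))) / (pᵉ - 1)` for a `p⁻ᵉ`-linear map `ψ` and a valuation `v`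
on `K`; it is used for `f ≠ 0` and `e ≥ 1` only, where no expression `∞ - ∞` occurs. -/
def E {K : Type*} [Field K] (p e : ℕ) (f : K) (ψ : AddMonoid.End K)
    (v : AddValuation K (WithTop ℝ)) : EReal :=
  (toEReal (v f) - (((p : ℝ) ^ e : ℝ) : EReal) * toEReal (v (ψ f))) /
    (((p : ℝ) ^ e - 1 : ℝ) : EReal)

/-- The log discrepancy `A(v; ψ)` of a `p⁻ᵉ`-linear map `ψ` on `K`: the supremum of
`E(f, ψⁿ, v)` over `f ≠ 0` and `n ≥ 1`; the power `ψⁿ` is the `n`-fold composite. -/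
def mapLogDiscrepancy {K : Type*} [Field K] (p e : ℕ) (v : AddValuation K (WithTop ℝ))
    (ψ : AddMonoid.End K) : EReal :=
  ⨆ (n : ℕ) (_ : 1 ≤ n) (f : K) (_ : f ≠ 0), E p (n * e) f (ψ ^ n) v

/-- The restriction to a subring `R ⊆ K` of an additive map `ψ : K → K` preserving `R`. -/
def restrictEnd {R K : Type*} [CommRing R] [Field K] [Algebra R K] [FaithfulSMul R K]
    (ψ : AddMonoid.End K) (h : ∀ a : R, ∃ b : R, algebraMap R K b = ψ (algebraMap R K a)) :
    R →+ R :=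
  AddMonoidHom.mk' (fun a => (h a).choose) fun a b => by
    apply FaithfulSMul.algebraMap_injective R K
    refine (h (a + b)).choose_spec.trans ?_
    rw [map_add (algebraMap R K) (h a).choose, (h a).choose_spec, (h b).choose_spec, map_add,
      map_add]

theorem algebraMap_restrictEnd {R K : Type*} [CommRing R] [Field K] [Algebra R K]
    [FaithfulSMul R K] (ψ : AddMonoid.End K)
    (h : ∀ a : R, ∃ b : R, algebraMap R K b = ψ (algebraMap R K a)) (a : R) :
    algebraMap R K (restrictEnd ψ h a) = ψ (algebraMap R K a) :=
  (h a).choose_spec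

/-- The additive map `k → k` induced by an additive map `ψ : K → K` that preserves a subring
`R ⊆ K` and the kernel of a surjection `π : R → k`; it sends `π a` to `π (ψ a)`. -/
def inducedEnd {R k K : Type*} [CommRing R] [CommRing k] [Field K] [Algebra R K]
    [FaithfulSMul R K] (π : R →+* k) (hπ : Function.Surjective π) (ψ : AddMonoid.End K)
    (h₁ : ∀ a : R, ∃ b : R, algebraMap R K b = ψ (algebraMap R K a))
    (h₂ : ∀ a : R, π a = 0 → π (restrictEnd ψ h₁ a) = 0) : AddMonoid.End k :=
  (π : R →+ k).liftOfSurjective hπ ⟨(π : R →+ k).comp (restrictEnd ψ h₁), fun a ha => h₂ a ha⟩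

theorem inducedEnd_apply {R k K : Type*} [CommRing R] [CommRing k] [Field K] [Algebra R K]
    [FaithfulSMul R K] (π : R →+* k) (hπ : Function.Surjective π) (ψ : AddMonoid.End K)
    (h₁ : ∀ a : R, ∃ b : R, algebraMap R K b = ψ (algebraMap R K a))
    (h₂ : ∀ a : R, π a = 0 → π (restrictEnd ψ h₁ a) = 0) (a : R) :
    inducedEnd π hπ ψ h₁ h₂ (π a) = π (restrictEnd ψ h₁ a) :=
  (π : R →+ k).liftOfRightInverse_comp_apply _ (Function.rightInverse_surjInv hπ)
    ⟨(π : R →+ k).comp (restrictEnd ψ h₁), fun a ha => h₂ a ha⟩ a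

/-- The trivial valuation on a field: `0` on nonzero elements, `+∞` at `0`. -/
def trivialVal (K : Type*) [Field K] : AddValuation K (WithTop ℝ) :=
  open Classical in
  AddValuation.of (fun a => if a = 0 then ⊤ else 0) (by simp) (by simp)
    (fun a b => by by_cases ha : a = 0 <;> by_cases hb : b = 0 <;> simp [ha, hb]; split_ifs <;> simp)
    (fun a b => by by_cases ha : a = 0 <;> by_cases hb : b = 0 <;> simp [ha, hb])

/-- The normalized valuation `ord` on the fraction field `K` of a discrete valuation ring `R`:
a uniformizer has value `1`, units of `R` have value `0`. -/
def dvrVal (R K : Type*) [CommRing R] [IsDomain R] [IsDiscreteValuationRing R] [Field K]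
    [Algebra R K] [IsFractionRing R K] : AddValuation K (WithTop ℝ) :=
  open Classical in
  AddValuation.of
    (fun a => if a = 0 then ⊤ else
      (((-(WithZero.log ((IsDiscreteValuationRing.maximalIdeal R).valuation K a)) : ℤ) : ℝ) :
        WithTop ℝ))
    (by simp) (by simp)
    (fun a b => by
      by_cases ha : a = 0
      · subst ha
        rw [zero_add]
        exact min_le_right (α := WithTop ℝ) _ _
      by_cases hb : b = 0
      · subst hb
        rw [add_zero]
        exact min_le_left (α := WithTop ℝ) _ _
      by_cases hab : a + b = 0
      · simp [hab]
      simp only [ha, hb, hab, if_false, min_le_iff, WithTop.coe_le_coe, Int.cast_le, neg_le_neg_iff]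
      rw [WithZero.log_le_log (by simpa) (by simpa), WithZero.log_le_log (by simpa) (by simpa)]
      exact le_max_iff.1 (Valuation.map_add _ a b))
    (fun a b => by
      by_cases ha : a = 0
      · simp [ha]
      by_cases hb : b = 0
      · simp [hb]
      simp only [ha, hb, mul_eq_zero, or_self, if_false]
      rw [map_mul, WithZero.log_mul (by simpa) (by simpa), ← WithTop.coe_add]
      congr 1
      push_cast
      ring)

theorem dvrVal_algebraMap_nonneg {R K : Type*} [CommRing R] [IsDomain R]
    [IsDiscreteValuationRing R] [Field K] [Algebra R K] [IsFractionRing R K] (a : R) :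
    0 ≤ dvrVal R K (algebraMap R K a) := by
  classical
  let v := (IsDiscreteValuationRing.maximalIdeal R).valuation K
  change (0 : WithTop ℝ) ≤ if algebraMap R K a = 0 then ⊤ else
    (((-(WithZero.log (v (algebraMap R K a))) : ℤ) : ℝ) : WithTop ℝ)
  split_ifs with h
  · exact le_top
  · have h1 : v (algebraMap R K a) ≤ 1 :=
      IsDedekindDomain.HeightOneSpectrum.valuation_le_one _ a
    rw [← WithZero.log_le_log (by simpa using h) one_ne_zero, WithZero.log_one] at h1
    have h2 : (0 : ℝ) ≤ ((-(WithZero.log (v (algebraMap R K a))) : ℤ) : ℝ) := by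
      exact_mod_cast neg_nonneg.2 h1
    exact WithTop.coe_le_coe.2 h2

/-! ### Semivaluations on a scheme -/

/-- The value `a(x)` in the residue field `κ(x)` of an element `a` of `𝒪_{X,z}`, where `z` lies in
the closure of `x`. The local ring `𝒪_{Z,z}` of the reduced closure `Z` of `x` is the image. -/
def evalAt {X : Scheme.{u}} {x z : X} (h : x ⤳ z) : X.presheaf.stalk z →+* X.residueField x :=
  (X.residue x).hom.comp (X.presheaf.stalkSpecializes h).hom

theorem evalAt_germ {X : Scheme.{u}} {x z : X} (h : x ⤳ z) (U : X.Opens) (hz : z ∈ U) (hx : x ∈ U)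
    (r : Γ(X, U)) : evalAt h (X.presheaf.germ U z hz r) = X.evaluation U x hx r := by
  simp only [evalAt, RingHom.comp_apply]
  erw [TopCat.Presheaf.germ_stalkSpecializes_apply]
  rfl

/-- A semivaluation on `X`: a point `home` and a real-valued valuation on its residue field
(trivial valuations are allowed, and `0` has value `+∞`) that is centered on `X`, that is,
nonnegative on a local ring of the closure of `home`. -/
structure Semivaluation (X : Scheme.{u}) where
  home : X
  val : AddValuation (X.residueField home) (WithTop ℝ)
  centered : ∃ (z : X) (h : home ⤳ z), ∀ a : X.presheaf.stalk z, 0 ≤ val (evalAt h a)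

namespace Semivaluation

variable {X Y : Scheme.{u}}

/-- `c` is the center of `ζ`: it lies in the closure of the home, and the valuation ring of `ζ`
dominates the local ring at `c`. -/
def IsCenter (ζ : Semivaluation X) (c : X) : Prop :=
  ∃ h : ζ.home ⤳ c, ∀ a : X.presheaf.stalk c, 0 ≤ ζ.val (evalAt h a) ∧
    (0 < ζ.val (evalAt h a) ↔ a ∈ IsLocalRing.maximalIdeal (X.presheaf.stalk c))

theorem exists_isCenter (ζ : Semivaluation X) : ∃ c, ζ.IsCenter c := by
  obtain ⟨z, hz, hnn⟩ := ζ.centered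
  obtain ⟨_, ⟨U, hU, rfl⟩, hzU, -⟩ :=
    X.isBasis_affineOpens.exists_subset_of_mem_open (Set.mem_univ z) isOpen_univ
  have hU : IsAffineOpen U := hU
  have hxU : ζ.home ∈ U := hz.mem_open U.isOpen hzU
  set ev := (X.evaluation U ζ.home hxU).hom with hev
  have hR : ∀ r : Γ(X, U), 0 ≤ ζ.val (ev r) := fun r => by
    have := hnn (X.presheaf.germ U z hzU r)
    rwa [evalAt_germ hz U hzU hxU] at this
  let Q : Ideal Γ(X, U) :=
    { carrier := {r | 0 < ζ.val (ev r)}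
      add_mem' := fun {a b} ha hb => by
        simp only [Set.mem_ofPred_eq, map_add] at *
        exact ζ.val.map_lt_add ha hb
      zero_mem' := by simp
      smul_mem' := fun a b hb => by
        simp only [Set.mem_ofPred_eq, smul_eq_mul, map_mul, AddValuation.map_mul] at *
        exact lt_of_lt_of_le hb (le_add_of_nonneg_left (hR a)) }
  have hQ : Q.IsPrime :=
    { ne_top' := fun h => by
        have h1 : (1 : Γ(X, U)) ∈ Q := h ▸ Submodule.mem_top
        have h1 : 0 < ζ.val (ev 1) := h1
        simp at h1
      mem_or_mem' := fun {a b} hab => by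
        by_contra! hcon
        obtain ⟨ha, hb⟩ := hcon
        have hab : 0 < ζ.val (ev (a * b)) := hab
        have ha : ¬ 0 < ζ.val (ev a) := ha
        have hb : ¬ 0 < ζ.val (ev b) := hb
        have ha' := le_antisymm (not_lt.1 ha) (hR a)
        have hb' := le_antisymm (not_lt.1 hb) (hR b)
        simp [ha', hb'] at hab }
  let q : PrimeSpectrum Γ(X, U) := ⟨Q, hQ⟩
  let c : X := hU.fromSpec q
  have hcU : c ∈ U := by
    have : c ∈ Set.range hU.fromSpec := ⟨q, rfl⟩
    rwa [hU.range_fromSpec] at this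
  have hloc := hU.isLocalization_stalk' q hcU
  have hP : hU.primeIdealOf ⟨ζ.home, hxU⟩ ≤ q := by
    intro r hr
    change 0 < ζ.val (ev r)
    have hr0 : ev r = 0 := by
      rw [hU.primeIdealOf_eq_map_closedPoint] at hr
      have hr' : X.presheaf.germ U ζ.home hxU r ∈
        IsLocalRing.maximalIdeal (X.presheaf.stalk ζ.home) := hr
      have := (IsLocalRing.residue_eq_zero_iff _).2 hr'
      exact this
    rw [hr0]; simp
  have hspec : ζ.home ⤳ c := by
    have h1 := ((PrimeSpectrum.le_iff_specializes _ _).1 hP).map hU.fromSpec.continuous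
    have h2 := hU.fromSpec_primeIdealOf ⟨ζ.home, hxU⟩
    erw [h2] at h1
    exact h1
  let _ := X.presheaf.algebra_section_stalk (⟨c, hcU⟩ : U)
  have hloc : IsLocalization.AtPrime (X.presheaf.stalk c) Q := hloc
  refine ⟨c, hspec, fun a => ?_⟩
  obtain ⟨r, s, rfl⟩ := IsLocalization.exists_mk'_eq Q.primeCompl a
  have hs0 : ζ.val (ev s) = 0 := by
    have h := s.2
    have h : ¬ 0 < ζ.val (ev s) := h
    exact le_antisymm (not_lt.1 h) (hR _)
  have key : ζ.val (evalAt hspec (IsLocalization.mk' (X.presheaf.stalk c) r s)) =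
      ζ.val (ev r) := by
    have h1 := congrArg (fun t => ζ.val (evalAt hspec t))
      (IsLocalization.mk'_spec (X.presheaf.stalk c) r s)
    have h2 : ∀ t : Γ(X, U), evalAt hspec (algebraMap Γ(X, U) (X.presheaf.stalk c) t) = ev t :=
      fun t => evalAt_germ hspec U hcU hxU t
    simp only [map_mul, AddValuation.map_mul, h2, hs0, add_zero] at h1
    exact h1
  rw [key]
  refine ⟨hR r, ?_⟩
  rw [IsLocalization.AtPrime.mk'_mem_maximal_iff (X.presheaf.stalk c) Q r s]
  rfl

/-- The center of `ζ` on `X` (unique, since `X` is separated in the theorem). -/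
def center (ζ : Semivaluation X) : X := ζ.exists_isCenter.choose

theorem isCenter_center (ζ : Semivaluation X) : ζ.IsCenter ζ.center := ζ.exists_isCenter.choose_spec

/-- The trivial semivaluation `triv_x` at a point `x`. -/
def triv (x : X) : Semivaluation X where
  home := x
  val := trivialVal (X.residueField x)
  centered := ⟨x, specializes_rfl, fun a => by
    classical
    change (0 : WithTop ℝ) ≤ if evalAt specializes_rfl a = 0 then ⊤ else 0
    split_ifs <;> simp⟩

/-- The image of a semivaluation under a morphism `π : Y ⟶ X`: the home is the image of the home,
and the valuation is restricted along the extension of residue fields. -/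
def map (π : Y ⟶ X) (ζ : Semivaluation Y) : Semivaluation X where
  home := π ζ.home
  val := ζ.val.comap (π.residueFieldMap ζ.home).hom
  centered := by
    obtain ⟨z, h, hz⟩ := ζ.centered
    refine ⟨π z, h.map π.continuous, fun a => ?_⟩
    have key : (π.residueFieldMap ζ.home).hom (evalAt (h.map π.continuous) a) =
        evalAt h ((π.stalkMap z).hom a) := by
      have h1 := π.stalkSpecializes_stalkMap_apply _ _ h a
      have h2 := congrArg (fun φ : X.presheaf.stalk (π ζ.home) ⟶ _ => φ.hom
        ((X.presheaf.stalkSpecializes (h.map π.continuous)).hom a))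
        (Scheme.residue_residueFieldMap π ζ.home)
      exact h2.trans (congrArg (Y.residue ζ.home).hom h1)
    change 0 ≤ ζ.val ((π.residueFieldMap ζ.home).hom (evalAt (h.map π.continuous) a))
    rw [key]
    exact hz _

end Semivaluation


/-! ### Cartier subalgebras -/

section Cartier

variable (X : Scheme.{u}) [AlgebraicGeometry.IsIntegral X]

/-- The local ring `𝒪_{X,x}` as a subring of the function field. -/
def stalkSubring (x : X) : Subring X.functionField :=
  (algebraMap (X.presheaf.stalk x) X.functionField).range

/-- The sections over `U` (nonempty) of `𝒞^X_e = (Fᵉ)^! 𝒪_X`: the `p⁻ᵉ`-linear maps `ψ` on the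
function field with `ψ(𝒪_U) ⊆ 𝒪_U`; this inclusion of sheaves is expressed on stalks. -/
def cartierSections (p e : ℕ) (U : X.Opens) : AddSubgroup (AddMonoid.End X.functionField) where
  carrier := {ψ | IsPInvLinear p e ψ ∧
    ∀ x ∈ U, Set.MapsTo ψ (stalkSubring X x) (stalkSubring X x)}
  add_mem' := fun {ψ φ} hψ hφ =>
    ⟨fun f g => by
      change ψ _ + φ _ = f * (ψ g + φ g)
      rw [hψ.1, hφ.1, mul_add],
      fun x hx _ ha => add_mem (hψ.2 x hx ha) (hφ.2 x hx ha)⟩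
  zero_mem' := ⟨fun f g => (mul_zero f).symm, fun _ _ _ _ => zero_mem _⟩
  neg_mem' := fun {ψ} hψ =>
    ⟨fun f g => by
      change -ψ _ = f * -ψ g
      rw [hψ.1, mul_neg],
      fun x hx _ ha => neg_mem (hψ.2 x hx ha)⟩

/-- A Cartier subalgebra on `X`: a quasi-coherent sheaf of graded subrings `𝒟 = ⨁ 𝒟_e` of `𝒞^X`
(multiplication is composition) with `𝒟_0 = 𝒪_X = 𝒞^X_0`. It is given by its sections, which
for nonempty opens are subgroups of the additive endomorphisms of the function field; the values
on the empty open set play no role. -/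
structure CartierSubalgebra (p : ℕ) where
  sections : ℕ → X.Opens → AddSubgroup (AddMonoid.End X.functionField)
  le_cartierSections : ∀ e U, sections e U ≤ cartierSections X p e U
  zero_eq : ∀ U, sections 0 U = cartierSections X p 0 U
  mul_mem : ∀ d e U ψ φ, ψ ∈ sections d U → φ ∈ sections e U → ψ * φ ∈ sections (d + e) U
  mono : ∀ e U V, V ≤ U → sections e U ≤ sections e V
  glue : ∀ e (U : X.Opens), (U : Set X).Nonempty → ∀ ψ,
    (∀ x ∈ U, ∃ V : X.Opens, x ∈ V ∧ V ≤ U ∧ ψ ∈ sections e V) → ψ ∈ sections e U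
  /-- Over an affine open `U`, a section over the locus where `f` does not vanish extends to `U`
  after multiplication with a power of `f`. -/
  quasicoherent : ∀ e (U : X.Opens) [Nonempty U], IsAffineOpen U → ∀ (f : Γ(X, U)) ψ,
    ψ ∈ sections e (X.basicOpen f) →
      ∃ n : ℕ, mulEnd (X.germToFunctionField U f ^ n) * ψ ∈ sections e U

variable {X}

/-- If `z` specializes to `x`, then `𝒪_{X,x} ⊆ 𝒪_{X,z}` in the function field. -/
theorem stalkSpecializes_algebraMap {x z : X} (h : z ⤳ x) (a : X.presheaf.stalk x) :
    algebraMap (X.presheaf.stalk z) X.functionField ((X.presheaf.stalkSpecializes h).hom a) =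
      algebraMap (X.presheaf.stalk x) X.functionField a := by
  have h0 := X.presheaf.stalkSpecializes_comp
    ((genericPoint_spec X).specializes (Set.mem_univ z)) h
  exact congrArg (fun φ : X.presheaf.stalk x ⟶ X.functionField => φ.hom a) h0

/-- For `z` specializing to `x`, the ideal `I_{Z,x} ⊆ 𝒪_{X,x}` of the closure `Z` of `z`,
inside the function field. -/
def closureIdeal {x z : X} (h : z ⤳ x) : Set X.functionField :=
  algebraMap (X.presheaf.stalk x) X.functionField '' {a | evalAt h a = 0}

namespace CartierSubalgebra

variable {p : ℕ} (D : CartierSubalgebra X p)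

/-- The stalk `(𝒟_e)_x`, as a set of additive endomorphisms of the function field. -/
def stalk (e : ℕ) (x : X) : Set (AddMonoid.End X.functionField) :=
  {ψ | ∃ U : X.Opens, x ∈ U ∧ ψ ∈ D.sections e U}

/-- `𝒟_e ≠ 0` for some `e > 0`. -/
def Nonzero : Prop :=
  ∃ e : ℕ, 1 ≤ e ∧ ∃ U : X.Opens, (U : Set X).Nonempty ∧ ∃ ψ ∈ D.sections e U, ψ ≠ 0

/-- `𝒟` is sharply `F`-pure at `x`: some `ψ ∈ (𝒟_e)_x` with `e ≥ 1` is surjective as a function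
`𝒪_{X,x} → 𝒪_{X,x}`. -/
def SharplyFPureAt (x : X) : Prop :=
  ∃ e : ℕ, 1 ≤ e ∧ ∃ ψ ∈ D.stalk e x, Set.SurjOn ψ (stalkSubring X x) (stalkSubring X x)

/-- `𝒟` is strongly `F`-regular at `x`: for every nonzero `f ∈ 𝒪_{X,x}` there are `e ≥ 1` and
`ψ ∈ (𝒟_e)_x` with `ψ(f) = 1`. -/
def StronglyFRegularAt (x : X) : Prop :=
  ∀ f ∈ stalkSubring X x, f ≠ 0 → ∃ e : ℕ, 1 ≤ e ∧ ∃ ψ ∈ D.stalk e x, ψ f = 1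

def SharplyFPure : Prop := ∀ x : X, D.SharplyFPureAt x

def StronglyFRegular : Prop := ∀ x : X, D.StronglyFRegularAt x

/-- The closure `Z` of `z` is uniformly `𝒟`-compatible: `ψ(I_{Z,x}) ⊆ I_{Z,x}` for all `x`, all
`e ≥ 1` and all `ψ ∈ (𝒟_e)_x`. Points `x` outside `Z` impose no condition, as `I_{Z,x}` is then
the unit ideal. -/
def UniformlyCompatible (z : X) : Prop :=
  ∀ (x : X) (h : z ⤳ x) (e : ℕ), 1 ≤ e → ∀ ψ ∈ D.stalk e x,
    Set.MapsTo ψ (closureIdeal h) (closureIdeal h)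

theorem stalk_preserves {e : ℕ} {x z : X} (h : z ⤳ x) {ψ : AddMonoid.End X.functionField}
    (hψ : ψ ∈ D.stalk e x) (a : X.presheaf.stalk z) :
    ∃ b : X.presheaf.stalk z, algebraMap (X.presheaf.stalk z) X.functionField b =
      ψ (algebraMap (X.presheaf.stalk z) X.functionField a) := by
  obtain ⟨U, hxU, hU⟩ := hψ
  exact (D.le_cartierSections e U hU).2 z (h.mem_open U.isOpen hxU) ⟨a, rfl⟩

theorem stalk_mono {e : ℕ} {x z : X} (h : z ⤳ x) : D.stalk e x ⊆ D.stalk e z :=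
  fun _ ⟨U, hxU, hU⟩ => ⟨U, h.mem_open U.isOpen hxU, hU⟩

theorem evalAt_refl_eq_zero {e : ℕ} {x z : X} (hz : D.UniformlyCompatible z) (h : z ⤳ x)
    (he : 1 ≤ e) {ψ : AddMonoid.End X.functionField} (hψ : ψ ∈ D.stalk e x)
    (a : X.presheaf.stalk z) (ha : (X.residue z).hom a = 0) :
    (X.residue z).hom (restrictEnd ψ (D.stalk_preserves h hψ) a) = 0 := by
  have hev : ∀ a : X.presheaf.stalk z, evalAt (specializes_refl z) a = (X.residue z).hom a := by
    intro a
    simp [evalAt]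
  obtain ⟨b, hb, hb'⟩ := hz z specializes_rfl e he ψ (D.stalk_mono h hψ) ⟨a, (hev a).trans ha, rfl⟩
  have : restrictEnd ψ (D.stalk_preserves h hψ) a = b := by
    apply FaithfulSMul.algebraMap_injective (X.presheaf.stalk z) X.functionField
    rw [algebraMap_restrictEnd, hb']
  rw [this, ← hev]
  exact hb

/-- The exceptional restriction `ψ‖_Z` of `ψ ∈ (𝒟_e)_x` to the closure `Z` of `z`, where
`x ∈ Z`, as a map on the function field `κ(z)` of `Z`: it sends `a(z)` to `ψ(a)(z)` for
`a ∈ 𝒪_{X,z}`. -/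
def exceptionalRestriction {e : ℕ} {x z : X} (hz : D.UniformlyCompatible z) (h : z ⤳ x)
    (he : 1 ≤ e) {ψ : AddMonoid.End X.functionField} (hψ : ψ ∈ D.stalk e x) :
    AddMonoid.End (X.residueField z) :=
  inducedEnd (X.residue z).hom (X.residue_surjective z) ψ (D.stalk_preserves h hψ)
    (D.evalAt_refl_eq_zero hz h he hψ)

/-- The stalk at `x ∈ Z` of the degree `e ≥ 1` part of the exceptional restriction `𝒟‖_Z` to the
closure `Z` of `z`. -/
def restrictedStalk {z : X} (hz : D.UniformlyCompatible z) {x : X} (h : z ⤳ x) {e : ℕ}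
    (he : 1 ≤ e) : Set (AddMonoid.End (X.residueField z)) :=
  {φ | ∃ (ψ : AddMonoid.End X.functionField) (hψ : ψ ∈ D.stalk e x),
    φ = D.exceptionalRestriction hz h he hψ}

open Classical in
/-- The log discrepancy `A(ζ; 𝒟)`. If the closure `Z` of the home of `ζ = (w, z)` is uniformly
`𝒟`-compatible, this is the supremum of `A(w; φ)` over the nonzero `φ` in the stalk of
`(𝒟‖_Z)_e`, `e ≥ 1`, at the center of `ζ`; otherwise it is `+∞`. For the generic point, `Z = X` is
compatible and `𝒟‖_X = 𝒟`. -/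
def logDiscrepancy (ζ : Semivaluation X) : EReal :=
  if hz : D.UniformlyCompatible ζ.home then
    ⨆ (e : ℕ) (he : 1 ≤ e)
      (φ ∈ D.restrictedStalk hz ζ.isCenter_center.choose he) (_ : φ ≠ 0),
      mapLogDiscrepancy p e ζ.val φ
  else ⊤

end CartierSubalgebra

end Cartier

/-! ### `F`-finite schemes and the full Cartier algebra -/

section FFinite

variable (X : Scheme.{u}) [AlgebraicGeometry.IsIntegral X] (p : ℕ)

theorem charP_section [CharP X.functionField p] (U : X.Opens) [Nonempty U] : CharP Γ(X, U) p :=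
  RingHom.charP (X.germToFunctionField U).hom (X.germToFunctionField_injective U) p

/-- An integral scheme `X` of characteristic `p` is `F`-finite: the Frobenius morphism of `X` is
finite. As this morphism is the identity on points, it means that the Frobenius map of `Γ(X, U)` is
finite for all nonempty affine opens `U`. -/
class IsFFinite [Fact p.Prime] [CharP X.functionField p] : Prop where
  finite_frobenius : ∀ (U : X.Opens) [Nonempty U], IsAffineOpen U →
    letI := charP_section X p U
    (frobenius Γ(X, U) p).Finite

theorem algebraMap_stalk_algebraMap {X : Scheme.{u}} [AlgebraicGeometry.IsIntegral X]
    {U : X.Opens} [Nonempty U] {x : X} (hx : x ∈ U) (r : Γ(X, U)) :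
    algebraMap (X.presheaf.stalk x) X.functionField (X.presheaf.germ U x hx r) =
      algebraMap Γ(X, U) X.functionField r :=
  X.algebraMap_germ_eq_germToFunctionField hx r

theorem exists_frac {X : Scheme.{u}} [AlgebraicGeometry.IsIntegral X] {U : X.Opens} [Nonempty U]
    (hU : IsAffineOpen U) (P : PrimeSpectrum Γ(X, U)) (hx : hU.fromSpec P ∈ U)
    {a : X.functionField} (ha : a ∈ stalkSubring X (hU.fromSpec P)) :
    ∃ r s : Γ(X, U), s ∉ P.asIdeal ∧ IsUnit (X.presheaf.germ U (hU.fromSpec P) hx s) ∧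
      algebraMap Γ(X, U) X.functionField s * a = algebraMap Γ(X, U) X.functionField r := by
  have hloc := hU.isLocalization_stalk' P hx
  let _ := X.presheaf.algebra_section_stalk (⟨hU.fromSpec P, hx⟩ : U)
  have hloc : IsLocalization.AtPrime (X.presheaf.stalk (hU.fromSpec P)) P.asIdeal := hloc
  obtain ⟨b, rfl⟩ := ha
  obtain ⟨⟨r, s⟩, h⟩ := IsLocalization.surj P.asIdeal.primeCompl b
  refine ⟨r, s, s.2, IsLocalization.map_units (X.presheaf.stalk (hU.fromSpec P)) s, ?_⟩
  have h' := congrArg (algebraMap (X.presheaf.stalk (hU.fromSpec P)) X.functionField) h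
  rw [map_mul] at h'
  rw [← algebraMap_stalk_algebraMap hx, ← algebraMap_stalk_algebraMap hx, mul_comm]
  exact h'

theorem finite_generators {R S : Type*} [CommRing R] [CommRing S] (φ : R →+* S) (h : φ.Finite) :
    ∃ T : Finset S, ∀ M : AddSubmonoid S, (∀ c : R, ∀ m ∈ M, φ c * m ∈ M) → (∀ t ∈ T, t ∈ M) →
      ∀ m, m ∈ M := by
  algebraize [φ]
  obtain ⟨T, hT⟩ := h.fg_top
  refine ⟨T, fun M hM hTM m => ?_⟩
  have hm : m ∈ Submodule.span R (T : Set S) := by rw [hT]; trivial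
  induction hm using Submodule.span_induction with
  | mem t ht => exact hTM t ht
  | zero => exact zero_mem M
  | add a b _ _ ha hb => exact add_mem ha hb
  | smul c a _ ha =>
    rw [Algebra.smul_def]
    exact hM c a ha

theorem quasicoherent_cartierSections [Fact p.Prime] [CharP X.functionField p] [IsFFinite X p]
    (e : ℕ) (U : X.Opens) [Nonempty U] (hU : IsAffineOpen U) (f : Γ(X, U))
    (ψ : AddMonoid.End X.functionField) (hψ : ψ ∈ cartierSections X p e (X.basicOpen f)) :
    ∃ n : ℕ, mulEnd (X.germToFunctionField U f ^ n) * ψ ∈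
      cartierSections X p e U := by
  let R := Γ(X, U)
  let K := X.functionField
  have : CharP R p := charP_section X p U
  have hfin : (iterateFrobenius R p e).Finite := by
    clear hψ
    induction e with
    | zero => rw [iterateFrobenius_zero]; exact RingHom.Finite.id R
    | succ n ih =>
      rw [iterateFrobenius_eq_pow, pow_succ, ← iterateFrobenius_eq_pow]
      exact RingHom.Finite.comp ih (IsFFinite.finite_frobenius U hU)
  let A : Subring K := (algebraMap R K).range
  -- the values of `ψ` on sections over `U` have denominators a power of `f`
  have hden : ∀ r : R, ∃ n : ℕ, algebraMap R K (f ^ n) * ψ (algebraMap R K r) ∈ A := by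
    intro r
    let J : Ideal R :=
      { carrier := {t | algebraMap R K t * ψ (algebraMap R K r) ∈ A}
        add_mem' := fun {a b} ha hb => by
          change algebraMap R K (a + b) * _ ∈ A
          rw [map_add, add_mul]
          exact add_mem ha hb
        zero_mem' := by
          change algebraMap R K 0 * _ ∈ A
          rw [map_zero, zero_mul]
          exact zero_mem _
        smul_mem' := fun a b hb => by
          change algebraMap R K (a * b) * _ ∈ A
          rw [map_mul, mul_assoc]
          exact mul_mem ⟨a, rfl⟩ hb }
    suffices h : f ∈ J.radical from h
    rw [Ideal.radical_eq_sInf, Submodule.mem_sInf]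
    rintro P ⟨hJP, hP⟩
    by_contra hfP
    let c : X := hU.fromSpec ⟨P, hP⟩
    have hcU : c ∈ U := by
      have : c ∈ Set.range hU.fromSpec := ⟨_, rfl⟩
      rwa [hU.range_fromSpec] at this
    have hcf : c ∈ X.basicOpen f := by
      have : (⟨P, hP⟩ : PrimeSpectrum R) ∈ hU.fromSpec ⁻¹ᵁ X.basicOpen f := by
        rw [hU.fromSpec_preimage_basicOpen]
        exact hfP
      exact this
    obtain ⟨r', t, htP, -, ht⟩ := exists_frac hU ⟨P, hP⟩ hcU
      (hψ.2 c hcf ⟨X.presheaf.germ U c hcU r, algebraMap_stalk_algebraMap hcU r⟩)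
    exact htP (hJP ⟨r', ht.symm⟩)
  obtain ⟨S, hS⟩ := finite_generators _ hfin
  choose n hn using hden
  let N := S.sup n
  have hN : ∀ r : R, algebraMap R K (f ^ N) * ψ (algebraMap R K r) ∈ A := by
    let M : AddSubmonoid R :=
      { carrier := {r | algebraMap R K (f ^ N) * ψ (algebraMap R K r) ∈ A}
        add_mem' := fun {a b} ha hb => by
          change algebraMap R K (f ^ N) * ψ (algebraMap R K (a + b)) ∈ A
          rw [map_add, map_add, mul_add]
          exact add_mem ha hb
        zero_mem' := by
          change algebraMap R K (f ^ N) * ψ (algebraMap R K 0) ∈ A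
          rw [map_zero, map_zero, mul_zero]
          exact zero_mem _ }
    refine hS M (fun c a ha => ?_) fun s hs => ?_
    · change algebraMap R K (f ^ N) * ψ (algebraMap R K (c ^ p ^ e * a)) ∈ A
      rw [map_mul, map_pow (algebraMap R K) c, hψ.1, mul_left_comm]
      exact mul_mem ⟨c, rfl⟩ ha
    · have hle : n s ≤ N := Finset.le_sup hs
      change algebraMap R K (f ^ N) * ψ (algebraMap R K s) ∈ A
      rw [← Nat.sub_add_cancel hle, pow_add, map_mul, mul_assoc]
      exact mul_mem ⟨_, rfl⟩ (hn s)
  refine ⟨N, fun g h => ?_, fun x hx a ha => ?_⟩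
  · change X.germToFunctionField U f ^ N * ψ (g ^ p ^ e * h) =
      g * (X.germToFunctionField U f ^ N * ψ h)
    rw [hψ.1, mul_left_comm]
  · change X.germToFunctionField U f ^ N * ψ a ∈ stalkSubring X x
    have hP := hU.fromSpec_primeIdealOf ⟨x, hx⟩
    obtain ⟨P, rfl⟩ : ∃ P, hU.fromSpec P = x := ⟨_, hP⟩
    obtain ⟨r, s, -, hs, hrs⟩ := exists_frac hU P hx ha
    obtain ⟨t, ht⟩ := hN (s ^ (p ^ e - 1) * r)
    have hpe : p ^ e - 1 + 1 = p ^ e := Nat.sub_add_cancel (pow_pos (Fact.out : p.Prime).pos e)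
    have hsa : algebraMap R K (s ^ (p ^ e - 1) * r) = algebraMap R K s ^ p ^ e * a := by
      rw [map_mul, ← hpe, pow_succ, map_pow, mul_assoc]
      exact congrArg _ hrs.symm
    rw [hsa, hψ.1] at ht
    obtain ⟨w, hw⟩ := hs
    refine ⟨↑w⁻¹ * X.presheaf.germ U _ hx t, ?_⟩
    rw [map_mul, algebraMap_stalk_algebraMap, ht, ← algebraMap_stalk_algebraMap hx s, ← hw,
      mul_left_comm, ← mul_assoc (algebraMap (X.presheaf.stalk (hU.fromSpec P)) _ _)
        (algebraMap (X.presheaf.stalk (hU.fromSpec P)) _ _), ← map_mul, Units.inv_mul, map_one,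
      one_mul, map_pow]
    rfl

/-- The Cartier algebra `𝒞^X` of an `F`-finite integral scheme. -/
def cartierAlgebra [Fact p.Prime] [CharP X.functionField p] [IsFFinite X p] :
    CartierSubalgebra X p where
  sections := cartierSections X p
  le_cartierSections _ _ := le_rfl
  zero_eq _ := rfl
  mul_mem d e U ψ φ hψ hφ := by
    refine ⟨fun f g => ?_, fun x hx a ha => hψ.2 x hx (hφ.2 x hx ha)⟩
    change ψ (φ (f ^ p ^ (d + e) * g)) = f * ψ (φ g)
    rw [pow_add, pow_mul, hφ.1, hψ.1]
  mono e U V h ψ hψ := ⟨hψ.1, fun x hx => hψ.2 x (h hx)⟩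
  glue e U hU ψ h := by
    obtain ⟨x, hx⟩ := hU
    obtain ⟨V, -, -, hV⟩ := h x hx
    refine ⟨hV.1, fun y hy => ?_⟩
    obtain ⟨W, hyW, -, hW⟩ := h y hy
    exact hW.2 y hyW
  quasicoherent := fun e U _ hU f ψ hψ => quasicoherent_cartierSections X p e U hU f ψ hψ

end FFinite

/-! ### Divisors over `X` -/

/-- A divisor `E` over an integral scheme `X` (separated and noetherian): a prime divisor on a
normal integral scheme `Y` with a proper birational morphism `π : Y ⟶ X`. It is given by its
generic point, a point of `Y` of codimension one; on the normal noetherian scheme `Y` these are the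
points whose local ring is a discrete valuation ring. -/
structure DivisorOver (X : Scheme.{u}) where
  Y : Scheme.{u}
  integral : AlgebraicGeometry.IsIntegral Y
  normal : ∀ y : Y, IsIntegrallyClosed (Y.presheaf.stalk y)
  π : Y ⟶ X
  proper : IsProper π
  birational : ∃ U : X.Opens, (U : Set X).Nonempty ∧ IsIso (π ∣_ U)
  point : Y
  dvr : IsDiscreteValuationRing (Y.presheaf.stalk point)

/-- The function field of an integral scheme is the residue field at its generic point. -/
def functionFieldEquiv (Y : Scheme.{u}) [AlgebraicGeometry.IsIntegral Y] :
    Y.functionField ≃+* Y.residueField (genericPoint Y) :=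
  RingEquiv.ofBijective (Y.residue (genericPoint Y)).hom
    ⟨RingHom.injective (R := Y.functionField) _, Y.residue_surjective _⟩

/-- The valuation `ord_E`, as a semivaluation on `Y` with home the generic point. -/
def ordOn (Y : Scheme.{u}) [AlgebraicGeometry.IsIntegral Y] (y : Y)
    [IsDiscreteValuationRing (Y.presheaf.stalk y)] : Semivaluation Y where
  home := genericPoint Y
  val := (dvrVal (Y.presheaf.stalk y) Y.functionField).comap
    (functionFieldEquiv Y).symm.toRingHom
  centered := by
    refine ⟨y, (genericPoint_spec Y).specializes (Set.mem_univ y), fun a => ?_⟩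
    change 0 ≤ dvrVal (Y.presheaf.stalk y) Y.functionField ((functionFieldEquiv Y).symm
      (functionFieldEquiv Y (algebraMap (Y.presheaf.stalk y) Y.functionField a)))
    rw [RingEquiv.symm_apply_apply]
    exact dvrVal_algebraMap_nonneg a

/-- The valuation `ord_E` of a divisor over `X`, as a semivaluation on `X`. -/
def DivisorOver.ord {X : Scheme.{u}} (E : DivisorOver X) : Semivaluation X :=
  haveI := E.integral
  haveI := E.dvr
  (ordOn E.Y E.point).map E.π

end FLogDisc

end

noncomputable section

namespace FLogDisc

/-! ### Expressions for the log discrepancy of one map -/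

/-! If `ψ(f) = 1` with `f` in the local ring at the center of `ζ`, then the restriction of `ψ` to a
compatible `Z` sends the class of `f` to `1`, and the term of this class with `n = 1` in the log
discrepancy is `w(f) / (p ^ e - 1)`. It is nonnegative, and positive once `f` lies in the maximal
ideal at the center. Sharp `F`-purity supplies such an `f`; strong `F`-regularity allows `f` to be
any nonzero element of the maximal ideal, and one exists unless the center is the generic point,
which happens only for `triv_X`.

For the converses trivial semivaluations are enough. If sharp `F`-purity fails at `x`, no map in the
stalk at `x` takes a unit value, so the closure of `x` is compatible, all restrictions to it vanish,
and the log discrepancy of `triv_x` is `-∞` (`logDiscrepancy_triv_eq_bot`). On a compatible closure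
the log discrepancy of a trivial semivaluation is at most `0`, so positivity at all `x ≠ η` says
that no proper closure is compatible. If some `f ≠ 0` at `x` is never sent to `1`, the values `ψ(f)`
generate a proper nonzero ideal `J` stable under `𝒟`. An associated prime `P = (J : y)` is stable
too, because `y * ψ(a) = ψ(y ^ (p ^ e) * a)`. Quasi-coherence turns this stability at one point into
compatibility of a proper closure, a contradiction
(`stronglyFRegularAt_of_not_uniformlyCompatible`).

For the corollary, `𝒞^X` has nonzero maps of degree `1` by `F`-finiteness, and `ord_E` is not
`triv_X` because a birational morphism identifies the function fields. -/

theorem one_lt_pow_of_prime {p e : ℕ} [Fact p.Prime] (he : 1 ≤ e) : (1 : ℝ) < (p : ℝ) ^ e :=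
  one_lt_pow₀ (by exact_mod_cast (Fact.out : p.Prime).one_lt) (by omega)

theorem toEReal_nonneg {a : WithTop ℝ} (h : 0 ≤ a) : 0 ≤ toEReal a := by
  induction a using WithTop.recTopCoe with
  | top => exact le_top
  | coe r => exact EReal.coe_nonneg.2 (WithTop.coe_le_coe.1 h)

theorem toEReal_pos {a : WithTop ℝ} (h : 0 < a) : 0 < toEReal a := by
  induction a using WithTop.recTopCoe with
  | top => exact EReal.coe_lt_top 0
  | coe r => exact EReal.coe_pos.2 (WithTop.coe_lt_coe.1 h)

theorem toEReal_zero : toEReal 0 = 0 := rfl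

section Valuation

variable {K : Type*} [Field K] {p e : ℕ}

theorem E_of_map_eq_one {f : K} {ψ : AddMonoid.End K} (v : AddValuation K (WithTop ℝ))
    (h : ψ f = 1) : E p e f ψ v = toEReal (v f) / (((p : ℝ) ^ e - 1 : ℝ) : EReal) := by
  simp [E, h, toEReal_zero]

/-- A `p⁻ᵉ`-linear map taking `f` to a nonzero value takes a multiple of `f` to `1`. -/
theorem IsPInvLinear.map_inv_pow_mul {ψ : AddMonoid.End K} (hψ : IsPInvLinear p e ψ) {f : K}
    (hf : ψ f ≠ 0) : ψ ((ψ f)⁻¹ ^ p ^ e * f) = 1 := by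
  rw [hψ, inv_mul_cancel₀ hf]

variable [Fact p.Prime]

theorem mapLogDiscrepancy_nonneg (he : 1 ≤ e) {f : K} {ψ : AddMonoid.End K}
    {v : AddValuation K (WithTop ℝ)} (h : ψ f = 1) (hf : 0 ≤ v f) :
    0 ≤ mapLogDiscrepancy p e v ψ := by
  have h0 : f ≠ 0 := by rintro rfl; simp at h
  refine le_trans ?_ (le_iSup₂_of_le 1 le_rfl (le_iSup₂_of_le f h0 le_rfl))
  rw [pow_one, one_mul, E_of_map_eq_one v h]
  exact EReal.div_nonneg (toEReal_nonneg hf)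
    (EReal.coe_nonneg.2 (sub_nonneg.2 (one_lt_pow_of_prime he).le))

theorem mapLogDiscrepancy_pos (he : 1 ≤ e) {f : K} {ψ : AddMonoid.End K}
    {v : AddValuation K (WithTop ℝ)} (h : ψ f = 1) (hf : 0 < v f) :
    0 < mapLogDiscrepancy p e v ψ := by
  have h0 : f ≠ 0 := by rintro rfl; simp at h
  refine lt_of_lt_of_le ?_ (le_iSup₂_of_le 1 le_rfl (le_iSup₂_of_le f h0 le_rfl))
  rw [pow_one, one_mul, E_of_map_eq_one v h]
  exact EReal.div_pos (toEReal_pos hf)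
    (EReal.coe_pos.2 (sub_pos.2 (one_lt_pow_of_prime he))) (EReal.coe_ne_top _)

theorem trivialVal_apply_of_ne_zero {a : K} (ha : a ≠ 0) : trivialVal K a = 0 := by
  classical
  change (if a = 0 then ⊤ else 0 : WithTop ℝ) = 0
  rw [if_neg ha]

theorem trivialVal_nonneg (a : K) : 0 ≤ trivialVal K a := by
  by_cases ha : a = 0
  · simp [ha]
  · rw [trivialVal_apply_of_ne_zero ha]

/-- Since `f` has value `0` and `ψⁿ(f)` has value `0` or `+∞`, every term of the supremum is `0` or
`-∞`. -/
theorem mapLogDiscrepancy_trivialVal_nonpos (he : 1 ≤ e) (ψ : AddMonoid.End K) :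
    mapLogDiscrepancy p e (trivialVal K) ψ ≤ 0 := by
  refine iSup₂_le fun n hn => iSup₂_le fun f hf => ?_
  have hp := one_lt_pow_of_prime (p := p) (Nat.mul_le_mul hn he)
  rw [E, trivialVal_apply_of_ne_zero hf, toEReal_zero]
  refine EReal.div_nonpos_of_nonpos_of_nonneg ?_ (EReal.coe_nonneg.2 (sub_nonneg.2 hp.le))
  rw [zero_sub, EReal.neg_le_zero]
  exact mul_nonneg (EReal.coe_nonneg.2 (by positivity)) (toEReal_nonneg (trivialVal_nonneg _))

/-- A nonzero `p⁻ᵉ`-linear map does not vanish on all multiples of `f ≠ 0` by elements of a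
subring with fraction field `K`. -/
theorem IsPInvLinear.exists_mul_ne_zero {R : Type*} [CommRing R] [IsDomain R] [Algebra R K]
    [IsFractionRing R K] {ψ : AddMonoid.End K} (hψ : IsPInvLinear p e ψ) (h0 : ψ ≠ 0) {f : K}
    (hf : f ≠ 0) : ∃ r : R, ψ (algebraMap R K r * f) ≠ 0 := by
  obtain ⟨k, hk⟩ : ∃ k, ψ k ≠ 0 := by
    by_contra! h
    exact h0 (AddMonoidHom.ext h)
  obtain ⟨a, b, hb, hab⟩ := IsFractionRing.div_surjective (A := R) (k / f)
  have hb0 : algebraMap R K b ≠ 0 := IsFractionRing.to_map_ne_zero_of_mem_nonZeroDivisors hb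
  -- As `k / f = a / b`, this multiple of `f` is `b ^ (p ^ e) * k`, and `ψ` sends it to `b * ψ k`.
  refine ⟨b ^ (p ^ e - 1) * a, fun h => hk ?_⟩
  have hpe : p ^ e - 1 + 1 = p ^ e := Nat.sub_add_cancel (pow_pos (Fact.out : p.Prime).pos e)
  have h1 : algebraMap R K (b ^ (p ^ e - 1) * a) * f = algebraMap R K b ^ p ^ e * k := by
    rw [map_mul, map_pow, ← hpe, pow_succ, (div_eq_iff hb0).1 hab]
    field_simp
    rw [Nat.add_sub_cancel, mul_comm]
  rw [h1, hψ] at h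
  exact (mul_eq_zero.1 h).resolve_left hb0

end Valuation

/-! ### Points and local rings -/

section Points

variable {X : Scheme.{u}}

theorem evalAt_eq_residue {x z : X} (h : x ⤳ z) (a : X.presheaf.stalk z) :
    evalAt h a = (X.residue x).hom ((X.presheaf.stalkSpecializes h).hom a) :=
  rfl

theorem evalAt_rfl_eq_zero_iff {x : X} (a : X.presheaf.stalk x) :
    evalAt (specializes_refl x) a = 0 ↔ a ∈ IsLocalRing.maximalIdeal (X.presheaf.stalk x) := by
  have : evalAt (specializes_refl x) a = (X.residue x).hom a := by simp [evalAt]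
  rw [this]
  exact IsLocalRing.residue_eq_zero_iff a

theorem isUnit_stalkSpecializes_iff {x z : X} (h : z ⤳ x) (a : X.presheaf.stalk x) :
    IsUnit ((X.presheaf.stalkSpecializes h).hom a) ↔ evalAt h a ≠ 0 := by
  rw [evalAt_eq_residue, ← not_iff_not, not_not]
  exact (IsLocalRing.residue_eq_zero_iff _).symm

theorem exists_affineOpen_mem (x : X) : ∃ U : X.Opens, IsAffineOpen U ∧ x ∈ U := by
  obtain ⟨_, ⟨U, hU, rfl⟩, hx, -⟩ :=
    X.isBasis_affineOpens.exists_subset_of_mem_open (Set.mem_univ x) isOpen_univ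
  exact ⟨U, hU, hx⟩

/-- Every prime ideal of `𝒪_{X,x}` is the ideal of the closure of a point specializing to `x`. -/
theorem exists_specializes_evalAt_eq_zero_iff (x : X) (P : Ideal (X.presheaf.stalk x))
    [hP : P.IsPrime] : ∃ (z : X) (h : z ⤳ x), ∀ a, evalAt h a = 0 ↔ a ∈ P := by
  obtain ⟨U, hU, hxU⟩ := exists_affineOpen_mem x
  obtain ⟨q, rfl⟩ : ∃ q : PrimeSpectrum Γ(X, U), hU.fromSpec q = x := ⟨_, hU.fromSpec_primeIdealOf ⟨x, hxU⟩⟩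
  have hloc := hU.isLocalization_stalk' q hxU
  let _ := X.presheaf.algebra_section_stalk (⟨hU.fromSpec q, hxU⟩ : U)
  have hloc : IsLocalization.AtPrime (X.presheaf.stalk (hU.fromSpec q)) q.asIdeal := hloc
  -- The contraction of `P` to the sections over an affine neighborhood of `x` gives the point
  -- sought.
  let Q : PrimeSpectrum Γ(X, U) := ⟨P.comap (algebraMap Γ(X, U) _), inferInstance⟩
  have hQq : Q ≤ q := by
    intro r hr
    by_contra hrq
    exact hP.ne_top (Ideal.eq_top_of_isUnit_mem _ hr
      (IsLocalization.map_units (X.presheaf.stalk (hU.fromSpec q)) (⟨r, hrq⟩ : q.asIdeal.primeCompl)))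
  have hspec : hU.fromSpec Q ⤳ hU.fromSpec q :=
    ((PrimeSpectrum.le_iff_specializes _ _).1 hQq).map hU.fromSpec.continuous
  have hzU : hU.fromSpec Q ∈ U := hspec.mem_open U.isOpen hxU
  have hgerm : ∀ r : Γ(X, U), evalAt hspec (algebraMap Γ(X, U) _ r) = 0 ↔
      algebraMap Γ(X, U) (X.presheaf.stalk (hU.fromSpec q)) r ∈ P := fun r => by
    have h1 : evalAt hspec (algebraMap Γ(X, U) (X.presheaf.stalk (hU.fromSpec q)) r) = _ :=
      evalAt_germ hspec U hxU hzU r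
    rw [h1, X.evaluation_eq_zero_iff_notMem_basicOpen]
    have h2 : hU.fromSpec Q ∈ X.basicOpen r ↔ Q ∈ hU.fromSpec ⁻¹ᵁ X.basicOpen r := Iff.rfl
    rw [h2, hU.fromSpec_preimage_basicOpen]
    exact not_not
  refine ⟨_, hspec, fun a => ?_⟩
  obtain ⟨r, s, rfl⟩ := IsLocalization.exists_mk'_eq q.asIdeal.primeCompl a
  have hu := IsLocalization.map_units (X.presheaf.stalk (hU.fromSpec q)) s
  have h1 := IsLocalization.mk'_spec (X.presheaf.stalk (hU.fromSpec q)) r s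
  have h2 := hgerm r
  rw [← h1, map_mul, mul_eq_zero, or_iff_left (hu.map (evalAt hspec)).ne_zero,
    Ideal.mul_unit_mem_iff_mem P hu] at h2
  exact h2

section Integral

variable [AlgebraicGeometry.IsIntegral X]

theorem genericPoint_specializes' (x : X) : genericPoint X ⤳ x :=
  (genericPoint_spec X).specializes (Set.mem_univ x)

/-- The local ring at `z` consists of fractions of elements of the local ring at a
specialization `x`. -/
theorem exists_frac_of_specializes {x z : X} (h : z ⤳ x) (a : X.presheaf.stalk z) :
    ∃ r s : X.presheaf.stalk x, evalAt h s ≠ 0 ∧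
      (X.presheaf.stalkSpecializes h).hom s * a = (X.presheaf.stalkSpecializes h).hom r := by
  obtain ⟨U, hU, hxU⟩ := exists_affineOpen_mem x
  have : Nonempty U := ⟨⟨x, hxU⟩⟩
  have hzU : z ∈ U := h.mem_open U.isOpen hxU
  obtain ⟨Q, rfl⟩ : ∃ Q, hU.fromSpec Q = z := ⟨_, hU.fromSpec_primeIdealOf ⟨z, hzU⟩⟩
  obtain ⟨r, s, -, hs, hrs⟩ := exists_frac hU Q hzU ⟨a, rfl⟩
  have hgerm : ∀ t, (X.presheaf.stalkSpecializes h).hom (X.presheaf.germ U x hxU t) =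
      X.presheaf.germ U _ hzU t := fun t => by
    erw [TopCat.Presheaf.germ_stalkSpecializes_apply]
  refine ⟨X.presheaf.germ U x hxU r, X.presheaf.germ U x hxU s, ?_, ?_⟩
  · rw [← isUnit_stalkSpecializes_iff, hgerm]
    exact hs
  · apply FaithfulSMul.algebraMap_injective _ X.functionField
    rw [hgerm, hgerm, map_mul, algebraMap_stalk_algebraMap, algebraMap_stalk_algebraMap]
    exact hrs

theorem evalAt_genericPoint_eq_zero {x : X} (h : genericPoint X ⤳ x) {a : X.presheaf.stalk x}
    (ha : evalAt h a = 0) : a = 0 := by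
  have h1 : (X.residue (genericPoint X)).hom (algebraMap _ X.functionField a) = 0 := ha
  have h2 := (map_eq_zero_iff _ (RingHom.injective (R := X.functionField)
    (X.residue (genericPoint X)).hom)).1 h1
  exact (map_eq_zero_iff _ (FaithfulSMul.algebraMap_injective _ _)).1 h2

/-- If evaluation at `z` were injective on the local ring at `x`, a function near `x` vanishing at
`z` would vanish at the generic point. Every neighborhood of the generic point would then contain
`z`. -/
theorem exists_evalAt_eq_zero {x z : X} (h : z ⤳ x) (hz : z ≠ genericPoint X) :
    ∃ a : X.presheaf.stalk x, a ≠ 0 ∧ evalAt h a = 0 := by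
  by_contra! hinj
  refine hz (Specializes.antisymm ?_ (genericPoint_specializes' z)).eq
  rw [specializes_iff_forall_open]
  intro V hVo hV
  obtain ⟨U, hU, hxU⟩ := exists_affineOpen_mem x
  have : Nonempty U := ⟨⟨x, hxU⟩⟩
  have hηU : genericPoint X ∈ U := (genericPoint_specializes' x).mem_open U.isOpen hxU
  have hzU : z ∈ U := h.mem_open U.isOpen hxU
  obtain ⟨f, hfV, hηf⟩ := hU.exists_basicOpen_le (V := ⟨V, hVo⟩) ⟨genericPoint X, hV⟩ hηU
  apply hfV
  by_contra hzf
  rw [← X.evaluation_eq_zero_iff_notMem_basicOpen z hzU, ← evalAt_germ h U hxU hzU] at hzf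
  have h0 : X.presheaf.germ U x hxU f = 0 := by
    by_contra h0
    exact hinj _ h0 hzf
  have h1 := (X.evaluation_eq_zero_iff_notMem_basicOpen _ hηU f).1 (by
    rw [← evalAt_germ (genericPoint_specializes' x) U hxU hηU, h0, map_zero])
  exact h1 hηf

end Integral

end Points

/-! ### Stalks of Cartier subalgebras -/

namespace CartierSubalgebra

variable {X : Scheme.{u}} [AlgebraicGeometry.IsIntegral X] {p : ℕ} (D : CartierSubalgebra X p)
  {x z : X} {d e : ℕ}

variable {D}

theorem isPInvLinear_of_mem_stalk {ψ : AddMonoid.End X.functionField} (hψ : ψ ∈ D.stalk e x) :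
    IsPInvLinear p e ψ := by
  obtain ⟨U, -, hU⟩ := hψ
  exact (D.le_cartierSections e U hU).1

theorem mapsTo_of_mem_stalk {ψ : AddMonoid.End X.functionField} (hψ : ψ ∈ D.stalk e x) :
    Set.MapsTo ψ (stalkSubring X x) (stalkSubring X x) := by
  obtain ⟨U, hx, hU⟩ := hψ
  exact (D.le_cartierSections e U hU).2 x hx

theorem mul_mem_stalk {ψ φ : AddMonoid.End X.functionField} (hψ : ψ ∈ D.stalk d x)
    (hφ : φ ∈ D.stalk e x) : ψ * φ ∈ D.stalk (d + e) x := by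
  obtain ⟨U, hxU, hU⟩ := hψ
  obtain ⟨V, hxV, hV⟩ := hφ
  exact ⟨U ⊓ V, ⟨hxU, hxV⟩, D.mul_mem d e _ _ _ (D.mono _ _ _ inf_le_left hU)
    (D.mono _ _ _ inf_le_right hV)⟩

/-- Here `𝒟_0 = 𝒪_X` enters: it lets the local ring act on the maps from both sides, without
changing their degree. -/
theorem mulEnd_mem_stalk (a : X.presheaf.stalk x) :
    mulEnd (algebraMap (X.presheaf.stalk x) X.functionField a) ∈ D.stalk 0 x := by
  obtain ⟨U, hxU, s, rfl⟩ := X.presheaf.exists_germ_eq a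
  have : Nonempty U := ⟨⟨x, hxU⟩⟩
  refine ⟨U, hxU, ?_⟩
  rw [D.zero_eq]
  refine ⟨fun f g => ?_, fun y hy b hb => ?_⟩
  · change _ * (f ^ p ^ 0 * g) = f * (_ * g)
    rw [pow_zero, pow_one, mul_left_comm]
  · change _ * b ∈ stalkSubring X y
    refine Subring.mul_mem _ ⟨X.presheaf.germ U y hy s, ?_⟩ hb
    rw [algebraMap_stalk_algebraMap, algebraMap_stalk_algebraMap]

theorem mulEnd_mul_mem_stalk (a : X.presheaf.stalk x) {ψ : AddMonoid.End X.functionField}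
    (hψ : ψ ∈ D.stalk e x) :
    mulEnd (algebraMap (X.presheaf.stalk x) X.functionField a) * ψ ∈ D.stalk e x := by
  have := mul_mem_stalk (D.mulEnd_mem_stalk a) hψ
  rwa [zero_add] at this

theorem mul_mulEnd_mem_stalk (a : X.presheaf.stalk x) {ψ : AddMonoid.End X.functionField}
    (hψ : ψ ∈ D.stalk e x) :
    ψ * mulEnd (algebraMap (X.presheaf.stalk x) X.functionField a) ∈ D.stalk e x :=
  mul_mem_stalk hψ (D.mulEnd_mem_stalk a)

/-- Quasi-coherence on stalks: a germ at `z` becomes a germ at a specialization `x` after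
multiplication with a function on `X` near `x` that does not vanish at `z`. -/
theorem exists_mulEnd_mul_mem_stalk (h : z ⤳ x) {ψ : AddMonoid.End X.functionField}
    (hψ : ψ ∈ D.stalk e z) : ∃ g : X.presheaf.stalk x, evalAt h g ≠ 0 ∧
      mulEnd (algebraMap (X.presheaf.stalk x) X.functionField g) * ψ ∈ D.stalk e x := by
  obtain ⟨V, hzV, hV⟩ := hψ
  obtain ⟨U, hU, hxU⟩ := exists_affineOpen_mem x
  have : Nonempty U := ⟨⟨x, hxU⟩⟩
  have hzU : z ∈ U := h.mem_open U.isOpen hxU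
  obtain ⟨f, hfV, hzf⟩ := hU.exists_basicOpen_le (V := V) ⟨z, hzV⟩ hzU
  obtain ⟨n, hn⟩ := D.quasicoherent e U hU f ψ (D.mono _ _ _ hfV hV)
  refine ⟨X.presheaf.germ U x hxU f ^ n, ?_, U, hxU, ?_⟩
  · rw [map_pow, evalAt_germ h U hxU hzU]
    exact pow_ne_zero n fun h0 => (X.evaluation_eq_zero_iff_notMem_basicOpen z hzU f).1 h0 hzf
  · rw [map_pow, algebraMap_stalk_algebraMap]
    exact hn

/-- A nonzero section on any nonempty open set gives a germ at the generic point, which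
quasi-coherence carries to `x` after multiplication by a nonzero function. -/
theorem Nonzero.exists_mem_stalk (hD : D.Nonzero) (x : X) :
    ∃ e, 1 ≤ e ∧ ∃ ψ ∈ D.stalk e x, ψ ≠ 0 := by
  obtain ⟨e, he, U, ⟨y, hy⟩, ψ, hψ, hψ0⟩ := hD
  have hη : ψ ∈ D.stalk e (genericPoint X) :=
    ⟨U, (genericPoint_specializes' y).mem_open U.isOpen hy, hψ⟩
  obtain ⟨g, hg, hgψ⟩ := exists_mulEnd_mul_mem_stalk (genericPoint_specializes' x) hη
  refine ⟨e, he, _, hgψ, fun h0 => hψ0 (AddMonoidHom.ext fun k => ?_)⟩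
  have h1 : algebraMap (X.presheaf.stalk x) X.functionField g * ψ k = 0 := DFunLike.congr_fun h0 k
  refine (mul_eq_zero.1 h1).resolve_left fun h2 => hg ?_
  rw [(map_eq_zero_iff _ (FaithfulSMul.algebraMap_injective _ _)).1 h2, map_zero]

theorem exists_algebraMap_eq {ψ : AddMonoid.End X.functionField} (hψ : ψ ∈ D.stalk e x) (a : X.presheaf.stalk x) :
    ∃ b : X.presheaf.stalk x, algebraMap _ X.functionField b = ψ (algebraMap _ _ a) :=
  D.stalk_preserves specializes_rfl hψ a

end CartierSubalgebra

namespace CartierSubalgebra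

variable {X : Scheme.{u}} [AlgebraicGeometry.IsIntegral X] {p : ℕ} {D : CartierSubalgebra X p}
  {x z : X} {e : ℕ}

/-! ### From `F`-singularities to log discrepancies -/

/-- The restriction is defined through the local ring at `z`; this computes it on the local ring at
a specialization such as the center, where the valuation is known to be nonnegative. -/
theorem exceptionalRestriction_evalAt (hz : D.UniformlyCompatible z) (h : z ⤳ x) (he : 1 ≤ e)
    {ψ : AddMonoid.End X.functionField} (hψ : ψ ∈ D.stalk e x) {a b : X.presheaf.stalk x}
    (hab : algebraMap _ X.functionField b = ψ (algebraMap _ _ a)) :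
    D.exceptionalRestriction hz h he hψ (evalAt h a) = evalAt h b := by
  rw [evalAt_eq_residue, evalAt_eq_residue]
  refine (inducedEnd_apply _ _ _ _ _ _).trans (congrArg _ ?_)
  apply FaithfulSMul.algebraMap_injective (X.presheaf.stalk z) X.functionField
  rw [algebraMap_restrictEnd, stalkSpecializes_algebraMap, stalkSpecializes_algebraMap, hab]

theorem le_logDiscrepancy {ζ : Semivaluation X} (hz : D.UniformlyCompatible ζ.home) (he : 1 ≤ e)
    {ψ : AddMonoid.End X.functionField} (hψ : ψ ∈ D.stalk e ζ.center)
    (h0 : D.exceptionalRestriction hz ζ.isCenter_center.choose he hψ ≠ 0) :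
    mapLogDiscrepancy p e ζ.val (D.exceptionalRestriction hz ζ.isCenter_center.choose he hψ) ≤
      D.logDiscrepancy ζ := by
  rw [logDiscrepancy, dif_pos hz]
  exact le_iSup₂_of_le e he (le_iSup₂_of_le _ ⟨ψ, hψ, rfl⟩ (le_iSup_of_le h0 le_rfl))

theorem exceptionalRestriction_eq_one (hz : D.UniformlyCompatible z) (h : z ⤳ x) (he : 1 ≤ e)
    {ψ : AddMonoid.End X.functionField} (hψ : ψ ∈ D.stalk e x) {a : X.presheaf.stalk x}
    (ha : ψ (algebraMap _ X.functionField a) = 1) :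
    D.exceptionalRestriction hz h he hψ (evalAt h a) = 1 := by
  rw [exceptionalRestriction_evalAt hz h he hψ (b := 1) (by rw [map_one, ha]), map_one]

theorem exceptionalRestriction_ne_zero (hz : D.UniformlyCompatible z) (h : z ⤳ x) (he : 1 ≤ e)
    {ψ : AddMonoid.End X.functionField} (hψ : ψ ∈ D.stalk e x) {a : X.presheaf.stalk x}
    (ha : ψ (algebraMap _ X.functionField a) = 1) :
    D.exceptionalRestriction hz h he hψ ≠ 0 := fun h0 => by
  have h1 := exceptionalRestriction_eq_one hz h he hψ ha
  rw [h0] at h1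
  exact zero_ne_one h1

theorem logDiscrepancy_nonneg_of_sharplyFPureAt [Fact p.Prime] {ζ : Semivaluation X}
    (h : D.SharplyFPureAt ζ.center) : 0 ≤ D.logDiscrepancy ζ := by
  by_cases hz : D.UniformlyCompatible ζ.home
  · obtain ⟨e, he, ψ, hψ, hs⟩ := h
    obtain ⟨_, ⟨a, rfl⟩, ha⟩ := hs (one_mem _)
    exact (mapLogDiscrepancy_nonneg he
      (exceptionalRestriction_eq_one hz ζ.isCenter_center.choose he hψ ha)
      (ζ.isCenter_center.choose_spec a).1).trans
      (le_logDiscrepancy hz he hψ (exceptionalRestriction_ne_zero hz _ he hψ ha))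
  · rw [logDiscrepancy, dif_neg hz]
    exact le_top

theorem logDiscrepancy_pos_of_map_eq_one [Fact p.Prime] {ζ : Semivaluation X} (he : 1 ≤ e)
    {ψ : AddMonoid.End X.functionField} (hψ : ψ ∈ D.stalk e ζ.center)
    {a : X.presheaf.stalk ζ.center} (ha : ψ (algebraMap _ X.functionField a) = 1)
    (hpos : a ∈ IsLocalRing.maximalIdeal (X.presheaf.stalk ζ.center)) :
    0 < D.logDiscrepancy ζ := by
  by_cases hz : D.UniformlyCompatible ζ.home
  · exact (mapLogDiscrepancy_pos he
      (exceptionalRestriction_eq_one hz ζ.isCenter_center.choose he hψ ha)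
      ((ζ.isCenter_center.choose_spec a).2.2 hpos)).trans_le
      (le_logDiscrepancy hz he hψ (exceptionalRestriction_ne_zero hz _ he hψ ha))
  · rw [logDiscrepancy, dif_neg hz]
    exact EReal.zero_lt_top

/-- A semivaluation centered at the generic point of `X` is trivial. -/
theorem _root_.FLogDisc.Semivaluation.eq_triv_of_isCenter_genericPoint {ζ : Semivaluation X}
    (h : ζ.IsCenter (genericPoint X)) : ζ = Semivaluation.triv (genericPoint X) := by
  obtain ⟨home, val, hc⟩ := ζ
  obtain ⟨hs, h⟩ := h
  obtain rfl : home = genericPoint X := (hs.antisymm (genericPoint_specializes' home)).eq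
  have hval : val = trivialVal _ := by
    ext b
    obtain ⟨a, rfl⟩ := X.residue_surjective _ b
    by_cases hb : (X.residue (genericPoint X)).hom a = 0
    · have hb' : (X.residue (genericPoint X)) a = 0 := hb
      simp [hb']
    -- A nonzero residue comes from outside the maximal ideal, where domination forces the value
    -- `0`.
    · have hu : a ∉ IsLocalRing.maximalIdeal (X.presheaf.stalk (genericPoint X)) :=
        fun ha => hb ((IsLocalRing.residue_eq_zero_iff a).2 ha)
      have he : evalAt hs a = (X.residue (genericPoint X)).hom a := by simp [evalAt]
      have h2 : val ((X.residue (genericPoint X)).hom a) = 0 :=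
        le_antisymm (not_lt.1 fun h1 => hu ((h a).2.1 (by rw [he]; exact h1)))
          (by rw [← he]; exact (h a).1)
      exact h2.trans (trivialVal_apply_of_ne_zero hb).symm
  subst hval
  rfl

theorem logDiscrepancy_pos_of_stronglyFRegularAt [Fact p.Prime] {ζ : Semivaluation X}
    (hζ : ζ ≠ Semivaluation.triv (genericPoint X)) (h : D.StronglyFRegularAt ζ.center) :
    0 < D.logDiscrepancy ζ := by
  have hc : ζ.center ≠ genericPoint X := fun hc =>
    hζ (Semivaluation.eq_triv_of_isCenter_genericPoint (hc ▸ ζ.isCenter_center))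
  -- Off the generic point the maximal ideal at the center has a nonzero element, and its value is
  -- positive.
  obtain ⟨a, ha0, ha⟩ := exists_evalAt_eq_zero (specializes_refl ζ.center) hc
  obtain ⟨e, he, ψ, hψ, h1⟩ := h _ ⟨a, rfl⟩
    fun h0 => ha0 ((map_eq_zero_iff _ (FaithfulSMul.algebraMap_injective _ _)).1 h0)
  exact logDiscrepancy_pos_of_map_eq_one he hψ h1 ((evalAt_rfl_eq_zero_iff a).1 ha)

/-! ### From trivial semivaluations to `F`-singularities -/

/-- Positivity at `triv_z` can thus only come from the value `+∞`, that is, from failure of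
compatibility. -/
theorem logDiscrepancy_triv_nonpos [Fact p.Prime] (hz : D.UniformlyCompatible z) :
    D.logDiscrepancy (Semivaluation.triv z) ≤ 0 := by
  rw [logDiscrepancy, dif_pos (show D.UniformlyCompatible (Semivaluation.triv z).home from hz)]
  exact iSup₂_le fun e he => iSup₂_le fun φ _ => iSup_le fun _ =>
    mapLogDiscrepancy_trivialVal_nonpos he φ

/-- If no map sends an element of the local ring at `z` to a unit, then the closure of `z` is
uniformly compatible and all exceptional restrictions vanish. -/
theorem logDiscrepancy_triv_eq_bot
    (h : ∀ e, 1 ≤ e → ∀ ψ ∈ D.stalk e z, ∀ a b : X.presheaf.stalk z,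
      algebraMap _ X.functionField b = ψ (algebraMap _ _ a) →
      b ∈ IsLocalRing.maximalIdeal (X.presheaf.stalk z)) :
    D.logDiscrepancy (Semivaluation.triv z) = ⊥ := by
  -- A germ of `𝒟` at `x` is also one at `z`, so the hypothesis at `z` governs all specializations
  -- of `z`.
  have key : ∀ {x} (hzx : z ⤳ x) (e) (_ : 1 ≤ e) (ψ) (_ : ψ ∈ D.stalk e x)
      (a b : X.presheaf.stalk x), algebraMap _ X.functionField b = ψ (algebraMap _ _ a) →
      evalAt hzx b = 0 := by
    intro x hzx e he ψ hψ a b hab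
    rw [evalAt_eq_residue]
    refine (IsLocalRing.residue_eq_zero_iff _).2 (h e he ψ (D.stalk_mono hzx hψ)
      ((X.presheaf.stalkSpecializes hzx).hom a) _ ?_)
    rw [stalkSpecializes_algebraMap, stalkSpecializes_algebraMap, hab]
  have hz : D.UniformlyCompatible z := by
    rintro x hzx e he ψ hψ _ ⟨a, -, rfl⟩
    obtain ⟨b, hb⟩ := exists_algebraMap_eq hψ a
    exact ⟨b, key hzx e he ψ hψ a b hb, hb⟩
  rw [logDiscrepancy, dif_pos (show D.UniformlyCompatible (Semivaluation.triv z).home from hz),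
    eq_bot_iff]
  refine iSup₂_le fun e he => iSup₂_le ?_
  rintro φ ⟨ψ, hψ, rfl⟩
  refine iSup_le fun h0 => (h0 (AddMonoidHom.ext fun k => ?_)).elim
  obtain ⟨a, rfl⟩ := X.residue_surjective z k
  have hψz : ψ ∈ D.stalk e z := D.stalk_mono (Semivaluation.triv z).isCenter_center.choose hψ
  obtain ⟨b, hb⟩ := exists_algebraMap_eq hψz a
  refine (inducedEnd_apply _ _ _ _ _ _).trans ((IsLocalRing.residue_eq_zero_iff _).2 ?_)
  exact h e he ψ hψz a _ (algebraMap_restrictEnd _ _ _)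

theorem exists_map_eq_one_of_isUnit {ψ : AddMonoid.End X.functionField} (hψ : ψ ∈ D.stalk e x)
    {f : X.functionField} {b : X.presheaf.stalk x} (hb : IsUnit b)
    (hbf : algebraMap _ X.functionField b = ψ f) : ∃ φ ∈ D.stalk e x, φ f = 1 := by
  obtain ⟨u, rfl⟩ := hb
  refine ⟨_, mulEnd_mul_mem_stalk (↑u⁻¹ : X.presheaf.stalk x) hψ, ?_⟩
  change _ * ψ f = 1
  rw [← hbf, ← map_mul, Units.inv_mul, map_one]

theorem surjOn_of_map_eq_one {ψ : AddMonoid.End X.functionField} (hψ : ψ ∈ D.stalk e x)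
    {f : X.functionField} (hf : f ∈ stalkSubring X x) (h1 : ψ f = 1) :
    Set.SurjOn ψ (stalkSubring X x) (stalkSubring X x) := fun g hg =>
  ⟨g ^ p ^ e * f, Subring.mul_mem _ (pow_mem hg _) hf, by
    rw [isPInvLinear_of_mem_stalk hψ, h1, mul_one]⟩

/-- A unit value could be rescaled to `1`, and a map with value `1` is surjective. Hence without
sharp `F`-purity no value is a unit. -/
theorem sharplyFPureAt_of_logDiscrepancy_triv
    (h : D.logDiscrepancy (Semivaluation.triv x) ≠ ⊥) : D.SharplyFPureAt x := by
  by_contra hx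
  refine h (logDiscrepancy_triv_eq_bot fun e he ψ hψ a b hab => ?_)
  by_contra hb
  obtain ⟨φ, hφ, h1⟩ := exists_map_eq_one_of_isUnit hψ (not_not.1 hb) hab
  exact hx ⟨e, he, φ, hφ, surjOn_of_map_eq_one hφ ⟨a, rfl⟩ h1⟩

/-- The local ring is the field `L`, on which every nonzero `p⁻ᵉ`-linear map is surjective. -/
theorem sharplyFPureAt_genericPoint (hD : D.Nonzero) : D.SharplyFPureAt (genericPoint X) := by
  obtain ⟨e, he, ψ, hψ, h0⟩ := hD.exists_mem_stalk (genericPoint X)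
  have hall : ∀ k, k ∈ stalkSubring X (genericPoint X) := fun k => by
    refine ⟨k, ?_⟩
    change (X.presheaf.stalkSpecializes (genericPoint_specializes' _)).hom k = k
    simp
  obtain ⟨k, hk⟩ : ∃ k, ψ k ≠ 0 := by
    by_contra! h
    exact h0 (AddMonoidHom.ext h)
  exact ⟨e, he, ψ, hψ, surjOn_of_map_eq_one hψ (hall _)
    ((isPInvLinear_of_mem_stalk hψ).map_inv_pow_mul hk)⟩

/-- Uniform compatibility of the closure of `z` fails already in the local ring of any
specialization `x` of `z`. -/
theorem exists_map_of_not_uniformlyCompatible [Fact p.Prime] (hz : ¬ D.UniformlyCompatible z)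
    (h : z ⤳ x) : ∃ e, 1 ≤ e ∧ ∃ ψ ∈ D.stalk e x, ∃ a b : X.presheaf.stalk x,
      evalAt h a = 0 ∧ evalAt h b ≠ 0 ∧ algebraMap _ X.functionField b = ψ (algebraMap _ _ a) := by
  rw [UniformlyCompatible] at hz
  push Not at hz
  obtain ⟨y, hzy, e, he, ψ, hψ, hcon⟩ := hz
  rw [Set.MapsTo] at hcon
  push Not at hcon
  obtain ⟨_, ⟨a, ha, rfl⟩, hcon⟩ := hcon
  obtain ⟨b, hb⟩ := exists_algebraMap_eq hψ a
  have hb0 : evalAt hzy b ≠ 0 := fun h0 => hcon ⟨b, h0, hb⟩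
  -- Compatibility may fail at a specialization `y` unrelated to `x`. The passage goes through `z`:
  -- there `a = r / s` with `r`, `s` from the local ring at `x`, and `g * ψ` is a germ at `x`.
  obtain ⟨r, s, hs, hrs⟩ := exists_frac_of_specializes h ((X.presheaf.stalkSpecializes hzy).hom a)
  obtain ⟨g, hg, hgψ⟩ := exists_mulEnd_mul_mem_stalk h (D.stalk_mono hzy hψ)
  have hrs' : algebraMap (X.presheaf.stalk x) X.functionField s * algebraMap _ _ a =
      algebraMap _ _ r := by
    rw [← stalkSpecializes_algebraMap h s, ← stalkSpecializes_algebraMap hzy a, ← map_mul, hrs,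
      stalkSpecializes_algebraMap]
  have hr0 : evalAt h r = 0 := by
    rw [evalAt_eq_residue, ← hrs, map_mul, ← evalAt_eq_residue hzy,
      show evalAt hzy a = 0 from ha, mul_zero]
  have hpe : p ^ e - 1 + 1 = p ^ e := Nat.sub_add_cancel (pow_pos (Fact.out : p.Prime).pos e)
  -- The argument is `s ^ (p ^ e) * a`, so only one factor `s` comes out of `ψ`.
  have hval : ψ (algebraMap _ _ (s ^ (p ^ e - 1) * r)) =
      algebraMap (X.presheaf.stalk x) X.functionField s * algebraMap _ _ b := by
    rw [hb, ← isPInvLinear_of_mem_stalk hψ, map_mul, map_pow, ← hrs', ← mul_assoc, ← pow_succ, hpe]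
  obtain ⟨c, hc⟩ := exists_algebraMap_eq hgψ (s ^ (p ^ e - 1) * r)
  refine ⟨e, he, _, hgψ, _, c, by rw [map_mul, hr0, mul_zero], ?_, hc⟩
  -- In the local ring at `z` the new value is `g * s * b`, and none of the factors vanishes at `z`.
  have hc' : (X.presheaf.stalkSpecializes h).hom c = (X.presheaf.stalkSpecializes h).hom (g * s) *
      (X.presheaf.stalkSpecializes hzy).hom b := by
    apply FaithfulSMul.algebraMap_injective (X.presheaf.stalk z) X.functionField
    rw [map_mul, stalkSpecializes_algebraMap, stalkSpecializes_algebraMap,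
      stalkSpecializes_algebraMap, hc, map_mul _ g s, mul_assoc, ← hval]
    rfl
  rw [evalAt_eq_residue, hc', map_mul, ← evalAt_eq_residue, ← evalAt_eq_residue, map_mul]
  exact mul_ne_zero (mul_ne_zero hg hs) hb0

theorem stronglyFRegularAt_of_not_uniformlyCompatible [Fact p.Prime]
    [IsNoetherianRing (X.presheaf.stalk x)] (hD : D.Nonzero)
    (h : ∀ z : X, z ≠ genericPoint X → ¬ D.UniformlyCompatible z) : D.StronglyFRegularAt x := by
  intro f hf hf0
  by_contra! hcon
  let O := X.presheaf.stalk x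
  let S : Set O := {b | ∃ e, 1 ≤ e ∧ ∃ ψ ∈ D.stalk e x, algebraMap O X.functionField b = ψ f}
  -- The span is needed because values of maps of different degrees need not add up to a value of
  -- one map.
  let J : Ideal O := Ideal.span S
  have hJtop : J ≠ ⊤ := by
    refine ne_top_of_le_ne_top (IsLocalRing.maximalIdeal.isMaximal O).ne_top (Ideal.span_le.2 ?_)
    rintro b ⟨e, he, ψ, hψ, hb⟩ hu
    obtain ⟨φ, hφ, h1⟩ := exists_map_eq_one_of_isUnit hψ hu hb
    exact hcon e he φ hφ h1
  -- `J` is nonzero and stable under all maps of positive degree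
  obtain ⟨t, htJ, ht0⟩ : ∃ t ∈ J, t ≠ 0 := by
    obtain ⟨e, he, ψ, hψ, hψ0⟩ := hD.exists_mem_stalk x
    -- The map `ψ` itself may kill `f`; precomposing with multiplication by `r` avoids this.
    obtain ⟨r, hr⟩ := (isPInvLinear_of_mem_stalk hψ).exists_mul_ne_zero (R := O) hψ0 hf0
    have hψr := mul_mulEnd_mem_stalk r hψ
    obtain ⟨b, hb⟩ := mapsTo_of_mem_stalk hψr hf
    refine ⟨b, Ideal.subset_span ⟨e, he, _, hψr, hb⟩, ?_⟩
    rintro rfl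
    rw [map_zero] at hb
    exact hr hb.symm
  have hJψ : ∀ e, 1 ≤ e → ∀ ψ ∈ D.stalk e x, ∀ a ∈ J, ∀ b : O,
      algebraMap O X.functionField b = ψ (algebraMap O X.functionField a) → b ∈ J := by
    intro e he ψ hψ a ha
    -- The map varies in the induction, so that a scalar `r` can be absorbed into it as `ψ * mulEnd
    -- r`.
    induction ha using Submodule.span_induction generalizing ψ with
    | mem a ha =>
      obtain ⟨d, hd, φ, hφ, ha⟩ := ha
      intro b hb
      exact Ideal.subset_span ⟨e + d, by omega, _, mul_mem_stalk hψ hφ, by rw [hb, ha]; rfl⟩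
    | zero =>
      intro b hb
      rw [map_zero, map_zero, map_eq_zero_iff _ (FaithfulSMul.algebraMap_injective _ _)] at hb
      rw [hb]
      exact J.zero_mem
    | add a a' _ _ iha iha' =>
      intro b hb
      obtain ⟨c, hc⟩ := exists_algebraMap_eq hψ a
      obtain ⟨c', hc'⟩ := exists_algebraMap_eq hψ a'
      have : b = c + c' := FaithfulSMul.algebraMap_injective O X.functionField <| by
        rw [hb, map_add, map_add, map_add, hc, hc']
      rw [this]
      exact J.add_mem (iha ψ hψ c hc) (iha' ψ hψ c' hc')
    | smul r a _ iha =>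
      intro b hb
      refine iha _ (mul_mulEnd_mem_stalk r hψ) b (hb.trans ?_)
      rw [smul_eq_mul, map_mul]
      rfl
  -- an associated prime of `J` is stable as well
  have : Nontrivial (O ⧸ J) := Ideal.Quotient.nontrivial_iff.2 hJtop
  obtain ⟨P, hP⟩ := associatedPrimes.nonempty O (O ⧸ J)
  obtain ⟨hPprime, y, hPy⟩ := isAssociatedPrime_iff.1 hP
  obtain ⟨y, rfl⟩ := Ideal.Quotient.mk_surjective y
  -- `P` is the annihilator of the class of `y`, that is, `P = (J : y)`.
  have hmem : ∀ a, a ∈ P ↔ a * y ∈ J := fun a => by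
    rw [hPy, Submodule.mem_colon_singleton, Submodule.mem_bot, ← Ideal.Quotient.eq_zero_iff_mem,
      map_mul]
    rfl
  obtain ⟨z, hzx, hzP⟩ := exists_specializes_evalAt_eq_zero_iff x P
  have hz : z ≠ genericPoint X := by
    rintro rfl
    exact ht0 (evalAt_genericPoint_eq_zero hzx
      ((hzP t).2 ((hmem t).2 (Ideal.mul_mem_right _ _ htJ))))
  obtain ⟨e, he, ψ, hψ, a, b, ha, hb, hab⟩ := exists_map_of_not_uniformlyCompatible (h z hz) hzx
  rw [hzP, hmem] at ha
  rw [Ne, hzP, hmem] at hb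
  have hpe : p ^ e - 1 + 1 = p ^ e := Nat.sub_add_cancel (pow_pos (Fact.out : p.Prime).pos e)
  -- From `a * y ∈ J` follows `y ^ (p ^ e) * a ∈ J`; applying `ψ` yields `y * b ∈ J`, hence `b ∈ P`.
  refine hb (hJψ e he ψ hψ (y ^ (p ^ e - 1) * (a * y)) (Ideal.mul_mem_left _ _ ha) _ ?_)
  rw [map_mul, hab, mul_comm, ← isPInvLinear_of_mem_stalk hψ, ← map_pow, ← map_mul]
  congr 2
  nth_rw 1 [← hpe]
  ring

/-! ### The characterization -/

theorem SharplyFPure.logDiscrepancy_nonneg [Fact p.Prime] (h : D.SharplyFPure) (ζ : Semivaluation X) :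
    0 ≤ D.logDiscrepancy ζ :=
  logDiscrepancy_nonneg_of_sharplyFPureAt (h _)

theorem StronglyFRegular.logDiscrepancy_pos [Fact p.Prime] (h : D.StronglyFRegular) {ζ : Semivaluation X}
    (hζ : ζ ≠ Semivaluation.triv (genericPoint X)) : 0 < D.logDiscrepancy ζ :=
  logDiscrepancy_pos_of_stronglyFRegularAt hζ (h _)

theorem triv_ne_triv_genericPoint (hx : x ≠ genericPoint X) :
    Semivaluation.triv x ≠ Semivaluation.triv (genericPoint X) :=
  fun h => hx (congrArg Semivaluation.home h)

/-- The generic point is left out so that this also covers the converse in the corollary, where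
`triv_X` is not tested; there `𝒟_e ≠ 0` suffices. -/
theorem sharplyFPure_of_logDiscrepancy_triv_nonneg (hD : D.Nonzero)
    (h : ∀ x : X, x ≠ genericPoint X → 0 ≤ D.logDiscrepancy (Semivaluation.triv x)) :
    D.SharplyFPure := fun x => by
  by_cases hx : x = genericPoint X
  · rw [hx]
    exact sharplyFPureAt_genericPoint hD
  · refine sharplyFPureAt_of_logDiscrepancy_triv fun h0 => ?_
    have := h x hx
    rw [h0, le_bot_iff] at this
    exact EReal.zero_ne_bot this

theorem stronglyFRegular_of_logDiscrepancy_triv_pos [Fact p.Prime] [AlgebraicGeometry.IsNoetherian X]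
    (hD : D.Nonzero)
    (h : ∀ x : X, x ≠ genericPoint X → 0 < D.logDiscrepancy (Semivaluation.triv x)) :
    D.StronglyFRegular := fun _ =>
  stronglyFRegularAt_of_not_uniformlyCompatible hD fun z hz hcomp =>
    (h z hz).not_ge (logDiscrepancy_triv_nonpos hcomp)

end CartierSubalgebra

/-! ### The full Cartier algebra -/

section FFinite

variable (X : Scheme.{u}) [AlgebraicGeometry.IsIntegral X] (p : ℕ)

/-- A `p⁻ᵉ`-linear map preserving the functions on a nonempty affine open `U` is a section of
`𝒞^X_e` over `U`. -/
theorem mem_cartierSections_of_forall [Fact p.Prime] {e : ℕ} {U : X.Opens} [Nonempty U]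
    (hU : IsAffineOpen U) {ψ : AddMonoid.End X.functionField} (hψ : IsPInvLinear p e ψ)
    (h : ∀ r : Γ(X, U), ∃ t : Γ(X, U),
      algebraMap _ X.functionField t = ψ (algebraMap Γ(X, U) X.functionField r)) :
    ψ ∈ cartierSections X p e U := by
  refine ⟨hψ, fun x hx a ha => ?_⟩
  obtain ⟨P, rfl⟩ : ∃ P, hU.fromSpec P = x := ⟨_, hU.fromSpec_primeIdealOf ⟨x, hx⟩⟩
  obtain ⟨r, s, -, ⟨w, hw⟩, hrs⟩ := exists_frac hU P hx ha
  -- With `a = r / s`, this element is `s ^ (p ^ e) * a`, so that `t = s * ψ a` with `s` a unit at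
  -- the point.
  obtain ⟨t, ht⟩ := h (s ^ (p ^ e - 1) * r)
  have hpe : p ^ e - 1 + 1 = p ^ e := Nat.sub_add_cancel (pow_pos (Fact.out : p.Prime).pos e)
  rw [map_mul, map_pow, ← hrs, ← mul_assoc, ← pow_succ, hpe, hψ] at ht
  refine ⟨↑w⁻¹ * X.presheaf.germ U _ hx t, ?_⟩
  rw [map_mul, algebraMap_stalk_algebraMap, ht, ← algebraMap_stalk_algebraMap hx s, ← hw,
    ← mul_assoc, ← map_mul, Units.inv_mul, map_one, one_mul]

/-- A field of characteristic `p` carries a nonzero `p⁻¹`-linear map. -/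
theorem exists_isPInvLinear_ne_zero (K : Type*) [Field K] [Fact p.Prime] [CharP K p] :
    ∃ ψ : AddMonoid.End K, IsPInvLinear p 1 ψ ∧ ψ ≠ 0 := by
  -- The map is a linear functional on `K` over the subfield of `p`-th powers, followed by the
  -- `p`-th root.
  let S := (frobenius K p).fieldRange
  let F : K ≃+* S := RingEquiv.ofBijective (frobenius K p).rangeRestrictField
    ⟨RingHom.injective _, fun ⟨_, a, ha⟩ => ⟨a, Subtype.ext ha⟩⟩
  obtain ⟨l, hl⟩ : ∃ l : Module.Dual S K, l 1 ≠ 0 := by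
    by_contra! h
    exact one_ne_zero ((Module.forall_dual_apply_eq_zero_iff S (1 : K)).1 h)
  refine ⟨F.symm.toAddMonoidHom.comp l.toAddMonoidHom, fun f g => ?_, fun h0 => hl ?_⟩
  · change F.symm (l (f ^ p ^ 1 * g)) = f * F.symm (l g)
    have h1 : f ^ p ^ 1 * g = F f • g := by
      rw [pow_one]
      rfl
    rw [h1, map_smul, smul_eq_mul, map_mul, RingEquiv.symm_apply_apply]
  · have h1 : F.symm (l 1) = 0 := DFunLike.congr_fun h0 1
    exact (map_eq_zero_iff _ F.symm.injective).1 h1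

/-- Take a nonzero `p⁻¹`-linear map on `L`. By `F`-finiteness finitely many sections over an affine
open generate all of them over the `p`-th powers, and a common denominator `b` of their images makes
`b * ψ` preserve the sections. -/
theorem cartierAlgebra_nonzero [Fact p.Prime] [CharP X.functionField p] [IsFFinite X p] :
    (cartierAlgebra X p).Nonzero := by
  classical
  obtain ⟨ψ, hψ, hψ0⟩ := exists_isPInvLinear_ne_zero p X.functionField
  obtain ⟨U, hU, hηU⟩ := exists_affineOpen_mem (genericPoint X)
  have : Nonempty U := ⟨⟨_, hηU⟩⟩
  have := charP_section X p U
  have := functionField_isFractionRing_of_isAffineOpen X U hU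
  let R := Γ(X, U)
  let K := X.functionField
  obtain ⟨T, hT⟩ := finite_generators _ (IsFFinite.finite_frobenius (p := p) U hU)
  obtain ⟨b, hb⟩ := IsLocalization.exist_integer_multiples_of_finset (nonZeroDivisors R)
    (T.image fun r => ψ (algebraMap R K r))
  have hb0 : algebraMap R K b ≠ 0 := IsFractionRing.to_map_ne_zero_of_mem_nonZeroDivisors b.2
  refine ⟨1, le_rfl, U, ⟨_, hηU⟩, mulEnd (algebraMap R K b) * ψ,
    mem_cartierSections_of_forall X p hU (fun f g => ?_) ?_, fun h0 => hψ0 ?_⟩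
  · change _ * ψ _ = f * (_ * ψ g)
    rw [hψ, mul_left_comm]
  · let M : AddSubmonoid R :=
      { carrier := {r | ∃ t : R, algebraMap R K t = algebraMap R K b * ψ (algebraMap R K r)}
        add_mem' := by
          rintro r r' ⟨t, ht⟩ ⟨t', ht'⟩
          exact ⟨t + t', by rw [map_add, ht, ht', map_add, map_add, mul_add]⟩
        zero_mem' := ⟨0, by rw [map_zero, map_zero, mul_zero]⟩ }
    refine hT M (fun c r ⟨t, ht⟩ => ⟨c * t, ?_⟩) fun r hr => ?_
    · have h1 : algebraMap R K (frobenius R p c * r) = algebraMap R K c ^ p ^ 1 * algebraMap R K r := by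
        rw [map_mul, frobenius_def, map_pow, pow_one]
      rw [h1, hψ, map_mul, ht, mul_left_comm]
    · obtain ⟨t, ht⟩ := hb _ (Finset.mem_image_of_mem _ hr)
      exact ⟨t, ht.trans (Algebra.smul_def _ _)⟩
  · ext k
    exact (mul_eq_zero.1 (DFunLike.congr_fun h0 k)).resolve_left hb0

end FFinite

/-! ### Divisors over `X` -/

theorem exists_dvrVal_ne_zero (R K : Type*) [CommRing R] [IsDomain R] [IsDiscreteValuationRing R]
    [Field K] [Algebra R K] [IsFractionRing R K] : ∃ a : K, a ≠ 0 ∧ dvrVal R K a ≠ 0 := by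
  classical
  obtain ⟨a, ha⟩ := (IsDiscreteValuationRing.maximalIdeal R).valuation_exists_uniformizer K
  have ha0 : a ≠ 0 := by
    rintro rfl
    rw [map_zero] at ha
    exact WithZero.exp_ne_zero ha.symm
  refine ⟨a, ha0, ?_⟩
  change (if a = 0 then ⊤ else (((-(WithZero.log
    ((IsDiscreteValuationRing.maximalIdeal R).valuation K a)) : ℤ) : ℝ) : WithTop ℝ)) ≠ 0
  rw [if_neg ha0, ha]
  simp

/-- Over `U` the morphism is an open immersion into `X`, hence an isomorphism on residue fields; the
inclusion of the preimage of `U` into `Y` is then cancelled. -/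
theorem residueFieldMap_surjective_of_isIso_restrict {X Y : Scheme.{u}} (π : Y ⟶ X) (U : X.Opens)
    [IsIso (π ∣_ U)] {y : Y} (hy : π y ∈ U) : Function.Surjective (π.residueFieldMap y).hom := by
  let y' : (π ⁻¹ᵁ U).toScheme := ⟨y, hy⟩
  have h1 : IsOpenImmersion ((π ⁻¹ᵁ U).ι ≫ π) := by
    rw [← morphismRestrict_ι]
    infer_instance
  have h2 : IsIso (((π ⁻¹ᵁ U).ι ≫ π).residueFieldMap y') := inferInstance
  rw [Scheme.residueFieldMap_comp] at h2
  have h3 : IsIso (π.residueFieldMap ((π ⁻¹ᵁ U).ι y')) :=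
    @IsIso.of_isIso_comp_right _ _ _ _ _ _ ((π ⁻¹ᵁ U).ι.residueFieldMap y') inferInstance h2
  exact (ConcreteCategory.bijective_of_isIso (π.residueFieldMap ((π ⁻¹ᵁ U).ι y'))).2

/-- A function on `Y` of nonzero order comes from the residue field of the home of `ord_E` on `X`,
since `π` is birational, so the restricted valuation stays nontrivial. -/
theorem DivisorOver.ord_ne_triv {X : Scheme.{u}} [AlgebraicGeometry.IsIntegral X]
    (E : DivisorOver X) : E.ord ≠ Semivaluation.triv (genericPoint X) := by
  have := E.integral
  have := E.dvr
  -- The type of `val` depends on the home, so the equation is substituted for a variable `ζ`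
  -- instead of being used for rewriting.
  have htriv : ∀ ζ : Semivaluation X, ζ = Semivaluation.triv (genericPoint X) →
      ∀ a, a ≠ 0 → ζ.val a = 0 := by
    rintro _ rfl a ha
    exact trivialVal_apply_of_ne_zero ha
  intro h
  obtain ⟨U, ⟨x, hx⟩, hiso⟩ := E.birational
  have hη : E.π (genericPoint E.Y) ∈ U := by
    -- The preimage of `U` is nonempty and open, hence contains the generic point of `Y`.
    obtain ⟨y, -⟩ := (E.π ∣_ U).surjective ⟨x, hx⟩
    exact (genericPoint_specializes' y.1).mem_open (E.π ⁻¹ᵁ U).isOpen y.2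
  obtain ⟨a, ha0, ha⟩ := exists_dvrVal_ne_zero (E.Y.presheaf.stalk E.point) E.Y.functionField
  obtain ⟨b, hb⟩ := residueFieldMap_surjective_of_isIso_restrict E.π U hη (functionFieldEquiv E.Y a)
  have hb0 : b ≠ 0 := by
    rintro rfl
    rw [map_zero] at hb
    exact ha0 ((map_eq_zero_iff _ (functionFieldEquiv E.Y).injective).1 hb.symm)
  have h1 : E.ord.val b = 0 := htriv _ h b hb0
  change dvrVal (E.Y.presheaf.stalk E.point) E.Y.functionField
    ((functionFieldEquiv E.Y).symm ((E.π.residueFieldMap (genericPoint E.Y)).hom b)) = 0 at h1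
  rw [hb, RingEquiv.symm_apply_apply] at h1
  exact ha h1

end FLogDisc

end

open FLogDisc in
theorem mainTheorem2 {p : ℕ} [Fact p.Prime] (X : Scheme.{u}) [AlgebraicGeometry.IsIntegral X]
    [AlgebraicGeometry.IsNoetherian X] [X.IsSeparated] [CharP X.functionField p]
    [IsFFinite X p] :
    -- the characterization, for every Cartier subalgebra with a nonzero part of positive degree
    (∀ D : CartierSubalgebra X p, D.Nonzero →
      ((D.SharplyFPure ↔ ∀ ζ : Semivaluation X, 0 ≤ D.logDiscrepancy ζ) ∧
       (D.StronglyFRegular ↔ ∀ ζ : Semivaluation X, ζ ≠ Semivaluation.triv (genericPoint X) →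
          0 < D.logDiscrepancy ζ)) ∧
      -- testing on trivial semivaluations
      ((D.SharplyFPure ↔ ∀ x : X, 0 ≤ D.logDiscrepancy (Semivaluation.triv x)) ∧
       (D.StronglyFRegular ↔ ∀ x : X, x ≠ genericPoint X →
          0 < D.logDiscrepancy (Semivaluation.triv x)))) ∧
    -- divisors over `X`
    ((cartierAlgebra X p).SharplyFPure →
      ∀ E : DivisorOver X, 0 ≤ (cartierAlgebra X p).logDiscrepancy E.ord) ∧
    ((cartierAlgebra X p).StronglyFRegular →
      ∀ E : DivisorOver X, 0 < (cartierAlgebra X p).logDiscrepancy E.ord) ∧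
    -- the converses, for the full Cartier algebra
    ((∀ ζ : Semivaluation X, ζ ≠ Semivaluation.triv (genericPoint X) →
        0 ≤ (cartierAlgebra X p).logDiscrepancy ζ) → (cartierAlgebra X p).SharplyFPure) ∧
    ((∀ ζ : Semivaluation X, ζ ≠ Semivaluation.triv (genericPoint X) →
        0 < (cartierAlgebra X p).logDiscrepancy ζ) → (cartierAlgebra X p).StronglyFRegular) := by
  refine ⟨fun D hD => ⟨⟨⟨fun h ζ => h.logDiscrepancy_nonneg ζ, fun h => ?_⟩,
    ⟨fun h ζ hζ => h.logDiscrepancy_pos hζ, fun h => ?_⟩⟩,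
    ⟨fun h x => h.logDiscrepancy_nonneg _, fun h => ?_⟩,
    ⟨fun h x hx => h.logDiscrepancy_pos (CartierSubalgebra.triv_ne_triv_genericPoint hx),
      fun h => ?_⟩⟩,
    fun h E => h.logDiscrepancy_nonneg _, fun h E => h.logDiscrepancy_pos E.ord_ne_triv,
    fun h => ?_, fun h => ?_⟩
  · exact CartierSubalgebra.sharplyFPure_of_logDiscrepancy_triv_nonneg hD fun x _ => h _
  · exact CartierSubalgebra.stronglyFRegular_of_logDiscrepancy_triv_pos hD fun x hx =>
      h _ (CartierSubalgebra.triv_ne_triv_genericPoint hx)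
  · exact CartierSubalgebra.sharplyFPure_of_logDiscrepancy_triv_nonneg hD fun x _ => h x
  · exact CartierSubalgebra.stronglyFRegular_of_logDiscrepancy_triv_pos hD h
  · exact CartierSubalgebra.sharplyFPure_of_logDiscrepancy_triv_nonneg
      (cartierAlgebra_nonzero X p) fun x hx =>
      h _ (CartierSubalgebra.triv_ne_triv_genericPoint hx)
  · exact CartierSubalgebra.stronglyFRegular_of_logDiscrepancy_triv_pos
      (cartierAlgebra_nonzero X p) fun x hx =>
      h _ (CartierSubalgebra.triv_ne_triv_genericPoint hx)
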